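/- Let $\Gamma_8=\langle a,b\mid b^{-1}aba^{-1}bab^{-1}a^{-1}ba^{-1}\rangle$ be the fundamental group of the figure-eight knot complement. Let $J=\begin{pmatrix}0&0&1\\0&1&0\\1&0&0\end{pmatrix}$, a Hermitian form of signature $(2,1)$, and put $\mathrm{U}(2,1)=\{A\in \mathrm{GL}_3(\mathbb C): A^*JA=J\}$, $\mathrm{SU}(2,1)=\{A\in\mathrm{U}(2,1):\det A=1\}$ and $\mathrm{Sp}(2,1)=\{A\in \mathrm{GL}_3(\mathbb H): A^*JA=J\}$, so that $\mathrm{SU}(2,1)\subset\mathrm{U}(2,1)\subset\mathrm{Sp}(2,1)$ through the inclusion $\mathbb C\subset\mathbb H$. Let $\rho_0:\Gamma_8\to\mathrm{SU}(2,1)\subset\mathrm{Sp}(2,1)$ be the representation with $$\rho_0(a)=\begin{pmatrix}1&1&\frac{-1-i\sqrt3}{2}\\0&1&-1\\0&0&1\end{pmatrix},\qquad \rho_0(b)=\begin{pmatrix}1&0&0\\1&1&0\\\frac{-1-i\sqrt3}{2}&-1&1\end{pmatrix}.$$ Every small deformation of $\rho_0$ in $\mathrm{Sp}(2,1)$ is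 conjugate to a representation into $\mathrm{U}(2,1)$: there is a neighbourhood $\mathcal N$ of $\rho_0$ in $\mathrm{Hom}(\Gamma_8,\mathrm{Sp}(2,1))$, with the topology of pointwise convergence, such that for every $\rho\in\mathcal N$ there are $g\in\mathrm{Sp}(2,1)$ and a homomorphism $\sigma:\Gamma_8\to\mathrm{U}(2,1)$ with $g\rho(\gamma)g^{-1}=\sigma(\gamma)$ for all $\gamma\in\Gamma_8$. -/

import Mathlib

open Matrix Quaternion Topology

noncomputable section

namespace FigureEight

/-- The relator `b⁻¹aba⁻¹bab⁻¹a⁻¹ba⁻¹` in the free group on two letters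
`a = of 0`, `b = of 1`. -/
def relator : FreeGroup (Fin 2) :=
  let a : FreeGroup (Fin 2) := FreeGroup.of 0
  let b : FreeGroup (Fin 2) := FreeGroup.of 1
  b⁻¹ * a * b * a⁻¹ * b * a * b⁻¹ * a⁻¹ * b * a⁻¹

/-- The figure-eight knot group `⟨a, b | b⁻¹aba⁻¹bab⁻¹a⁻¹ba⁻¹⟩`. -/
abbrev Gamma8 : Type := PresentedGroup ({relator} : Set (FreeGroup (Fin 2)))

/-- The first generator `a` of the figure-eight knot group. -/
def genA : Gamma8 := PresentedGroup.of 0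

/-- The second generator `b` of the figure-eight knot group. -/
def genB : Gamma8 := PresentedGroup.of 1

/-- The matrix of the Hermitian form `x̄₁y₃ + x̄₂y₂ + x̄₃y₁`, of signature `(2,1)`. -/
def formJ (R : Type) [Ring R] : Matrix (Fin 3) (Fin 3) R :=
  !![0, 0, 1; 0, 1, 0; 1, 0, 0]

/-- The group of invertible `3 × 3` matrices `g` over `R` that preserve the form `J`, that is
`g* J g = J`. The matrices act from the left on columns, scalars from the right, so that this is
also correct for the noncommutative ring of quaternions. -/
def formGroup (R : Type) [Ring R] [StarRing R] : Subgroup (Matrix (Fin 3) (Fin 3) R)ˣ where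
  carrier := {g | (g : Matrix (Fin 3) (Fin 3) R)ᴴ * formJ R * (g : Matrix (Fin 3) (Fin 3) R)
    = formJ R}
  one_mem' := by simp
  mul_mem' := by
    intro g h hg hh
    simp only [Set.mem_ofPred_eq] at hg hh ⊢
    rw [Units.val_mul, conjTranspose_mul]
    calc _ = (h : Matrix (Fin 3) (Fin 3) R)ᴴ * ((g : Matrix (Fin 3) (Fin 3) R)ᴴ * formJ R *
          (g : Matrix (Fin 3) (Fin 3) R)) * (h : Matrix (Fin 3) (Fin 3) R) := by
            simp only [Matrix.mul_assoc]
      _ = _ := by rw [hg, hh]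
  inv_mem' := by
    intro g hg
    simp only [Set.mem_ofPred_eq] at hg ⊢
    have h1 : (g : Matrix (Fin 3) (Fin 3) R) * ((g⁻¹ : (Matrix (Fin 3) (Fin 3) R)ˣ) :
        Matrix (Fin 3) (Fin 3) R) = 1 := Units.mul_inv g
    have h2 : ((g⁻¹ : (Matrix (Fin 3) (Fin 3) R)ˣ) : Matrix (Fin 3) (Fin 3) R)ᴴ *
        (g : Matrix (Fin 3) (Fin 3) R)ᴴ = 1 := by
      rw [← conjTranspose_mul, h1, conjTranspose_one]
    calc _ = ((g⁻¹ : (Matrix (Fin 3) (Fin 3) R)ˣ) : Matrix (Fin 3) (Fin 3) R)ᴴ *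
          ((g : Matrix (Fin 3) (Fin 3) R)ᴴ * formJ R * (g : Matrix (Fin 3) (Fin 3) R)) *
          ((g⁻¹ : (Matrix (Fin 3) (Fin 3) R)ˣ) : Matrix (Fin 3) (Fin 3) R) := by rw [hg]
      _ = (((g⁻¹ : (Matrix (Fin 3) (Fin 3) R)ˣ) : Matrix (Fin 3) (Fin 3) R)ᴴ *
          (g : Matrix (Fin 3) (Fin 3) R)ᴴ) * formJ R * ((g : Matrix (Fin 3) (Fin 3) R) *
          ((g⁻¹ : (Matrix (Fin 3) (Fin 3) R)ˣ) : Matrix (Fin 3) (Fin 3) R)) := by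
            simp only [Matrix.mul_assoc]
      _ = _ := by rw [h1, h2]; simp

/-- `U(2,1)`, the complex matrices preserving `J`. -/
abbrev U21 : Type := formGroup ℂ

/-- `Sp(2,1)`, the quaternionic matrices preserving `J`, with the topology given by the
matrix entries. -/
abbrev Sp21 : Type := formGroup ℍ[ℝ]

/-- `SU(2,1)`, the elements of `U(2,1)` of determinant one. -/
def SU21 : Subgroup U21 where
  carrier := {g | ((g : (Matrix (Fin 3) (Fin 3) ℂ)ˣ) : Matrix (Fin 3) (Fin 3) ℂ).det = 1}
  one_mem' := by simp
  mul_mem' := by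
    intro g h hg hh
    simp only [Set.mem_ofPred_eq] at hg hh ⊢
    simp [hg, hh]
  inv_mem' := by
    intro g hg
    simp only [Set.mem_ofPred_eq] at hg ⊢
    have h := congrArg Matrix.det (Units.mul_inv (g : (Matrix (Fin 3) (Fin 3) ℂ)ˣ))
    rw [Matrix.det_mul, hg, one_mul, Matrix.det_one] at h
    simpa using h

/-- The inclusion `U(2,1) ⊂ Sp(2,1)` induced by `ℂ = ℝ ⊕ ℝi ⊂ ℍ`. -/
def inclUSp : U21 →* Sp21 :=
  ((Units.map ((Quaternion.ofComplex.toRingHom.mapMatrix :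
      Matrix (Fin 3) (Fin 3) ℂ →+* Matrix (Fin 3) (Fin 3) ℍ[ℝ]) :
      Matrix (Fin 3) (Fin 3) ℂ →* Matrix (Fin 3) (Fin 3) ℍ[ℝ])).comp
    (formGroup ℂ).subtype).codRestrict (formGroup ℍ[ℝ]) (by
      intro g
      have hg : ((g : (Matrix (Fin 3) (Fin 3) ℂ)ˣ) : Matrix (Fin 3) (Fin 3) ℂ)ᴴ * formJ ℂ *
          ((g : (Matrix (Fin 3) (Fin 3) ℂ)ˣ) : Matrix (Fin 3) (Fin 3) ℂ) = formJ ℂ := g.2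
      have h := congrArg (Quaternion.ofComplex.toRingHom.mapMatrix :
        Matrix (Fin 3) (Fin 3) ℂ →+* Matrix (Fin 3) (Fin 3) ℍ[ℝ]) hg
      rw [map_mul, map_mul] at h
      have hJ : (Quaternion.ofComplex.toRingHom.mapMatrix :
          Matrix (Fin 3) (Fin 3) ℂ →+* Matrix (Fin 3) (Fin 3) ℍ[ℝ]) (formJ ℂ) = formJ ℍ[ℝ] := by
        ext1 i j
        fin_cases i <;> fin_cases j <;> simp [formJ]
      have hs : (Quaternion.ofComplex.toRingHom.mapMatrix :
          Matrix (Fin 3) (Fin 3) ℂ →+* Matrix (Fin 3) (Fin 3) ℍ[ℝ])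
          (((g : (Matrix (Fin 3) (Fin 3) ℂ)ˣ) : Matrix (Fin 3) (Fin 3) ℂ)ᴴ) =
          ((Quaternion.ofComplex.toRingHom.mapMatrix :
          Matrix (Fin 3) (Fin 3) ℂ →+* Matrix (Fin 3) (Fin 3) ℍ[ℝ])
          ((g : (Matrix (Fin 3) (Fin 3) ℂ)ˣ) : Matrix (Fin 3) (Fin 3) ℂ))ᴴ := by
        ext1 i j
        simp [conjTranspose_apply]
        ext <;> simp
      rw [hJ, hs] at h
      exact h)

/-- The topology of pointwise convergence on `Hom(Γ₈, Sp(2,1))`; as `Γ₈` is generated by `a`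
and `b`, it is the topology induced by `ρ ↦ (ρ a, ρ b)`. -/
instance instTopologicalSpaceHom : TopologicalSpace (Gamma8 →* Sp21) :=
  TopologicalSpace.induced (fun ρ γ => ρ γ) Pi.topologicalSpace

/-- The number `(-1 - i√3)/2`. -/
def eis : ℂ := (-1 - Complex.I * (Real.sqrt 3 : ℂ)) / 2

theorem eis_sq : eis ^ 2 = -1 - eis := by
  have h3 : ((Real.sqrt 3 : ℝ) : ℂ) ^ 2 = 3 := by
    rw [← Complex.ofReal_pow, Real.sq_sqrt (by norm_num)]; norm_num
  have hI := Complex.I_sq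
  unfold eis
  linear_combination (Complex.I ^ 2 / 4) * h3 + (3 / 4) * hI

theorem star_eis : star eis = -1 - eis := by
  simp only [eis, RCLike.star_def, map_div₀, map_sub, map_neg, map_mul, Complex.conj_I,
    Complex.conj_ofReal, map_one, map_ofNat]
  ring

/-- The matrix of `ρ₀(a)`. -/
def matA : Matrix (Fin 3) (Fin 3) ℂ :=
  !![1, 1, eis; 0, 1, -1; 0, 0, 1]

/-- The matrix of `ρ₀(b)`. -/
def matB : Matrix (Fin 3) (Fin 3) ℂ :=
  !![1, 0, 0; 1, 1, 0; eis, -1, 1]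

/-- The inverse of `matA`. -/
def matAinv : Matrix (Fin 3) (Fin 3) ℂ :=
  !![1, -1, -1 - eis; 0, 1, 1; 0, 0, 1]

/-- The inverse of `matB`. -/
def matBinv : Matrix (Fin 3) (Fin 3) ℂ :=
  !![1, 0, 0; -1, 1, 0; -1 - eis, 1, 1]

/-- `matA` as an invertible matrix. -/
def unitA : (Matrix (Fin 3) (Fin 3) ℂ)ˣ where
  val := matA
  inv := matAinv
  val_inv := by
    ext i j
    fin_cases i <;> fin_cases j <;> simp [matA, matAinv, Matrix.mul_apply, Fin.sum_univ_three]
    all_goals ring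
  inv_val := by
    ext i j
    fin_cases i <;> fin_cases j <;> simp [matA, matAinv, Matrix.mul_apply, Fin.sum_univ_three]
    all_goals ring

/-- `matB` as an invertible matrix. -/
def unitB : (Matrix (Fin 3) (Fin 3) ℂ)ˣ where
  val := matB
  inv := matBinv
  val_inv := by
    ext i j
    fin_cases i <;> fin_cases j <;> simp [matB, matBinv, Matrix.mul_apply, Fin.sum_univ_three]
    all_goals ring
  inv_val := by
    ext i j
    fin_cases i <;> fin_cases j <;> simp [matB, matBinv, Matrix.mul_apply, Fin.sum_univ_three]
    all_goals ring

theorem unitA_mem : unitA ∈ formGroup ℂ := by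
  change matAᴴ * formJ ℂ * matA = formJ ℂ
  have h : (starRingEnd ℂ) eis = -1 - eis := star_eis
  ext i j
  fin_cases i <;> fin_cases j <;>
    simp [matA, formJ, Matrix.mul_apply, Fin.sum_univ_three, h] <;>
    ring

theorem unitB_mem : unitB ∈ formGroup ℂ := by
  change matBᴴ * formJ ℂ * matB = formJ ℂ
  have h : (starRingEnd ℂ) eis = -1 - eis := star_eis
  ext i j
  fin_cases i <;> fin_cases j <;>
    simp [matB, formJ, Matrix.mul_apply, Fin.sum_univ_three, h] <;>
    ring

/-- `ρ₀(a)` as an element of `SU(2,1)`. -/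
def imgA : SU21 := ⟨⟨unitA, unitA_mem⟩, by
  change matA.det = 1
  simp [matA, Matrix.det_fin_three]⟩

/-- `ρ₀(b)` as an element of `SU(2,1)`. -/
def imgB : SU21 := ⟨⟨unitB, unitB_mem⟩, by
  change matB.det = 1
  simp [matB, Matrix.det_fin_three]⟩

theorem relation_holds :
    imgB⁻¹ * imgA * imgB * imgA⁻¹ * imgB * imgA * imgB⁻¹ * imgA⁻¹ * imgB * imgA⁻¹ = 1 := by
  apply Subtype.ext
  apply Subtype.ext
  apply Units.ext
  change matBinv * matA * matB * matAinv * matB * matA * matBinv * matAinv * matB * matAinv = 1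
  have h2 := eis_sq
  have e1 : (matBinv : Matrix (Fin 3) (Fin 3) ℂ) * matA =
      !![1, 1, 0 + 1 * eis; -1, 0, -1 - 1 * eis; -1 - 1 * eis, 0 - 1 * eis, 1] := by
    ext i j
    fin_cases i <;> fin_cases j <;>
      simp [matA, matB, matAinv, matBinv, Matrix.mul_apply, Fin.sum_univ_three] <;> grind
  have e2 : (!![1, 1, 0 + 1 * eis; -1, 0, -1 - 1 * eis; -1 - 1 * eis, 0 - 1 * eis, 1] : Matrix (Fin 3) (Fin 3) ℂ) * matB =
      !![1 - 1 * eis, 1 - 1 * eis, 0 + 1 * eis; 0, 1 + 1 * eis, -1 - 1 * eis; -1 - 1 * eis, -1 - 1 * eis, 1] := by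
    ext i j
    fin_cases i <;> fin_cases j <;>
      simp [matA, matB, matAinv, matBinv, Matrix.mul_apply, Fin.sum_univ_three] <;> grind
  have e3 : (!![1 - 1 * eis, 1 - 1 * eis, 0 + 1 * eis; 0, 1 + 1 * eis, -1 - 1 * eis; -1 - 1 * eis, -1 - 1 * eis, 1] : Matrix (Fin 3) (Fin 3) ℂ) * matAinv =
      !![1 - 1 * eis, 0, -1 - 1 * eis; 0, 1 + 1 * eis, 0; -1 - 1 * eis, 0, 0] := by
    ext i j
    fin_cases i <;> fin_cases j <;>
      simp [matA, matB, matAinv, matBinv, Matrix.mul_apply, Fin.sum_univ_three] <;> grind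
  have e4 : (!![1 - 1 * eis, 0, -1 - 1 * eis; 0, 1 + 1 * eis, 0; -1 - 1 * eis, 0, 0] : Matrix (Fin 3) (Fin 3) ℂ) * matB =
      !![2 - 1 * eis, 1 + 1 * eis, -1 - 1 * eis; 1 + 1 * eis, 1 + 1 * eis, 0; -1 - 1 * eis, 0, 0] := by
    ext i j
    fin_cases i <;> fin_cases j <;>
      simp [matA, matB, matAinv, matBinv, Matrix.mul_apply, Fin.sum_univ_three] <;> grind
  have e5 : (!![2 - 1 * eis, 1 + 1 * eis, -1 - 1 * eis; 1 + 1 * eis, 1 + 1 * eis, 0; -1 - 1 * eis, 0, 0] : Matrix (Fin 3) (Fin 3) ℂ) * matA =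
      !![2 - 1 * eis, 3, -1 + 1 * eis; 1 + 1 * eis, 2 + 2 * eis, -2 - 1 * eis; -1 - 1 * eis, -1 - 1 * eis, 1] := by
    ext i j
    fin_cases i <;> fin_cases j <;>
      simp [matA, matB, matAinv, matBinv, Matrix.mul_apply, Fin.sum_univ_three] <;> grind
  have e6 : (!![2 - 1 * eis, 3, -1 + 1 * eis; 1 + 1 * eis, 2 + 2 * eis, -2 - 1 * eis; -1 - 1 * eis, -1 - 1 * eis, 1] : Matrix (Fin 3) (Fin 3) ℂ) * matBinv =
      !![1, 2 + 1 * eis, -1 + 1 * eis; 0 + 1 * eis, 0 + 1 * eis, -2 - 1 * eis; -1 - 1 * eis, 0 - 1 * eis, 1] := by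
    ext i j
    fin_cases i <;> fin_cases j <;>
      simp [matA, matB, matAinv, matBinv, Matrix.mul_apply, Fin.sum_univ_three] <;> grind
  have e7 : (!![1, 2 + 1 * eis, -1 + 1 * eis; 0 + 1 * eis, 0 + 1 * eis, -2 - 1 * eis; -1 - 1 * eis, 0 - 1 * eis, 1] : Matrix (Fin 3) (Fin 3) ℂ) * matAinv =
      !![1, 1 + 1 * eis, 0 + 1 * eis; 0 + 1 * eis, 0, -1; -1 - 1 * eis, 1, 1] := by
    ext i j
    fin_cases i <;> fin_cases j <;>
      simp [matA, matB, matAinv, matBinv, Matrix.mul_apply, Fin.sum_univ_three] <;> grind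
  have e8 : (!![1, 1 + 1 * eis, 0 + 1 * eis; 0 + 1 * eis, 0, -1; -1 - 1 * eis, 1, 1] : Matrix (Fin 3) (Fin 3) ℂ) * matB =
      !![1, 1, 0 + 1 * eis; 0, 1, -1; 0, 0, 1] := by
    ext i j
    fin_cases i <;> fin_cases j <;>
      simp [matA, matB, matAinv, matBinv, Matrix.mul_apply, Fin.sum_univ_three] <;> grind
  have e9 : (!![1, 1, 0 + 1 * eis; 0, 1, -1; 0, 0, 1] : Matrix (Fin 3) (Fin 3) ℂ) * matAinv =
      !![1, 0, 0; 0, 1, 0; 0, 0, 1] := by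
    ext i j
    fin_cases i <;> fin_cases j <;>
      simp [matA, matB, matAinv, matBinv, Matrix.mul_apply, Fin.sum_univ_three] <;> grind
  rw [e1, e2, e3, e4, e5, e6, e7, e8, e9]
  ext i j
  fin_cases i <;> fin_cases j <;> simp

/-- The representation `ρ₀ : Γ₈ → SU(2,1)`, given on the generators by `imgA` and `imgB`. -/
def rho0SU : Gamma8 →* SU21 :=
  PresentedGroup.toGroup (f := ![imgA, imgB]) (by
    intro r hr
    rw [Set.mem_singleton_iff] at hr
    subst hr
    simpa [relator] using relation_holds)

theorem rho0SU_genA : rho0SU genA = imgA := by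
  simp [rho0SU, genA]

theorem rho0SU_genB : rho0SU genB = imgB := by
  simp [rho0SU, genB]

/-- The representation `ρ₀ : Γ₈ → SU(2,1) ⊂ U(2,1) ⊂ Sp(2,1)`. -/
def rho0 : Gamma8 →* Sp21 := (inclUSp.comp SU21.subtype).comp rho0SU

end FigureEight

end

open Matrix Quaternion Topology

namespace FigureEight

/-! ### Fox calculus for the relation `w b = a w`, where `w = b⁻¹aba⁻¹`. -/

section Algebra

variable {A : Type*} [Ring A]

/-! The centralizer of `i` in Sp(2,1) is U(2,1), so a representation `ρ` is conjugate into U(2,1)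
exactly when it commutes with some `k = g i g⁻¹`, `g` in Sp(2,1). As `ρ₀` commutes with `i`, one
looks for `k` near `i`.

Under Ad `ρ₀` the Lie algebra of Sp(2,1) splits as u(2,1) plus the skew elements anticommuting with
`i` (`skewAnti`). The second summand is the symmetric square of ℂ³, through `s ↦ s J j`
(`exists_symToQuat`, `toQuat_mul_symToQuat_mul`). An explicit computation shows that its H⁰ and H¹
vanish: `eq_zero_of_symmetric_invariant`, `exists_symmetric_coboundary`.

The passage from this infinitesimal fact to nearby representations
(`eventually_exists_conj_commute`) needs no smoothness of the representation variety. The defect `c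
= k - ρ k ρ⁻¹` satisfies exact equations: it is a coboundary for `ρ`, hence solves the Fox relation;
it is skew; and `k c + c k = c²`, because `k` and its conjugate both square to `-1`. The last
equation is read as linear in `c`, with one factor `c` regarded as a small coefficient. Since H⁰
vanishes, `k` can be chosen so that `c` also satisfies a slice condition transverse to the
coboundaries (`map_nhds_slice`). At `ρ₀` and `k = i` the linear equations describe cocycles with
values in `skewAnti` and zero slice component; H¹ = 0 leaves only zero (`injective_linSystem_base`).
Injectivity is an open condition, so `c = 0` for every nearby `ρ`. -/

/-- The value at `b⁻¹aba⁻¹` of the cocycle with values `ca`, `cb` at `a`, `b`, for the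
conjugation action given by `x`, `y` with inverses `x'`, `y'`. -/
def cocycleWord (x x' y y' ca cb : A) : A :=
  -(y' * cb * y) + y' * ca * y + y' * x * cb * x' * y
    - y' * x * y * x' * ca * x * y' * x' * y

/-- The Fox derivative of the relation `b⁻¹aba⁻¹ * b = a * b⁻¹aba⁻¹`. -/
def foxRelation (x x' y y' ca cb : A) : A :=
  cocycleWord x x' y y' ca cb + y' * x * y * x' * cb * x * y' * x' * y
    - ca - x * cocycleWord x x' y y' ca cb * x'

/-- A coboundary takes the value `k - w k w⁻¹` at every word `w`, and the two sides of the relation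
are the same element. The pair `x`, `y` is any solution of the relation, so this applies at the
deformed representation and not only at `ρ₀`. -/
theorem foxRelation_coboundary {x x' y y' : A} (hx : x * x' = 1) (hx' : x' * x = 1)
    (hy : y * y' = 1) (hy' : y' * y = 1)
    (hr : y' * x * y * x' * y = x * (y' * x * y * x')) (k : A) :
    foxRelation x x' y y' (k - x * k * x') (k - y * k * y') = 0 := by
  have c1 (z : A) : x * (x' * z) = z := by rw [← mul_assoc, hx, one_mul]
  have c2 (z : A) : x' * (x * z) = z := by rw [← mul_assoc, hx', one_mul]
  have c3 (z : A) : y * (y' * z) = z := by rw [← mul_assoc, hy, one_mul]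
  have c4 (z : A) : y' * (y * z) = z := by rw [← mul_assoc, hy', one_mul]
  have hw : cocycleWord x x' y y' (k - x * k * x') (k - y * k * y') =
      k - y' * x * y * x' * k * x * y' * x' * y := by
    simp only [cocycleWord, mul_sub, sub_mul, mul_assoc, c2, c4, hx', hy', mul_one]
    abel
  -- The relation `w y = x w` with both sides inverted.
  have hr' : y' * x * y' * x' * y = x * y' * x' * y * x' := by
    have h1 : (y' * x * y * x' * y) * (y' * x * y' * x' * y) = 1 := by
      simp only [mul_assoc, c1, c2, c3, hy']
    have h2 : (x * y' * x' * y * x') * (x * (y' * x * y * x')) = 1 := by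
      simp only [mul_assoc, c2, c3, c4, hx]
    rw [← hr] at h2
    exact (left_inv_eq_right_inv h2 h1).symm
  rw [foxRelation, hw]
  have e : y' * x * y * x' * (y * k * y') * x * y' * x' * y =
      x * (y' * x * y * x' * k * x * y' * x' * y) * x' := by
    calc _ = (y' * x * y * x' * y) * k * (y' * x * y' * x' * y) := by simp only [mul_assoc]
      _ = _ := by rw [hr, hr']; simp only [mul_assoc]
  simp only [mul_sub, sub_mul] at e ⊢
  rw [e]
  abel

/-- For two square roots `k`, `l` of `-1`, the difference anticommutes with `k` to first order. -/
theorem mul_sub_add_sub_mul_of_sq_eq_neg_one {k l : A} (hk : k * k = -1) (hl : l * l = -1) :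
    k * (k - l) + (k - l) * k = (k - l) * (k - l) := by
  simp only [mul_sub, sub_mul, hk, hl]
  abel

end Algebra

/-! ### The slice map and its derivative. -/

section Analysis

variable {A : Type*} [NormedRing A] [NormedAlgebra ℝ A]

/-- The elements that anticommute with `i` and are skew for `sharp`. -/
def skewAnti (sharp : A →ₗ[ℝ] A) (i : A) : Submodule ℝ A where
  carrier := {z | i * z = -(z * i) ∧ sharp z = -z}
  zero_mem' := by simp
  add_mem' := by
    rintro z w ⟨hz, hz'⟩ ⟨hw, hw'⟩
    refine ⟨?_, ?_⟩
    · rw [mul_add, hz, hw, add_mul]; abel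
    · rw [map_add, hz', hw']; abel
  smul_mem' := by
    rintro c z ⟨hz, hz'⟩
    refine ⟨?_, ?_⟩
    · rw [mul_smul_comm, hz, smul_mul_assoc, smul_neg]
    · rw [map_smul, hz', smul_neg]

/-- The map `z ↦ [i, (1 - z)² x (1 + z)²] x₀'`. -/
def sliceEntry (i x₀' x z : A) : A :=
  (i * ((1 - z) * (1 - z) * x * ((1 + z) * (1 + z)))
    - (1 - z) * (1 - z) * x * ((1 + z) * (1 + z)) * i) * x₀'

/-- The derivative of `sliceEntry` in `z` at `z = 0`. -/
def sliceDeriv (i x₀ x₀' : A) : A →ₗ[ℝ] A where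
  toFun z := (i * (2 • (x₀ * z - z * x₀)) - (2 • (x₀ * z - z * x₀)) * i) * x₀'
  map_add' z w := by simp only [mul_add, add_mul, mul_sub, sub_mul, smul_add, smul_sub]; abel
  map_smul' c z := by
    simp only [mul_smul_comm, smul_mul_assoc, ← smul_sub, RingHom.id_apply, smul_comm c (2 : ℕ)]

/-- `sliceEntry` is polynomial, inverses having been cleared. Only the partial derivative in `z` is
recorded; the one in `x` plays no role. -/
theorem exists_hasStrictFDerivAt_sliceEntry (i x₀ x₀' : A) :
    ∃ f' : A × A →L[ℝ] A,
      HasStrictFDerivAt (fun p : A × A => sliceEntry i x₀' p.1 p.2) f' (x₀, 0) ∧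
      ∀ z, f' (0, z) = sliceDeriv i x₀ x₀' z := by
  have h1 : HasStrictFDerivAt (fun p : A × A => p.1) (ContinuousLinearMap.fst ℝ A A) (x₀, 0) :=
    hasStrictFDerivAt_fst
  have h2 : HasStrictFDerivAt (fun p : A × A => p.2) (ContinuousLinearMap.snd ℝ A A) (x₀, 0) :=
    hasStrictFDerivAt_snd
  have hm := h2.const_sub 1
  have hp := h2.const_add 1
  have hF := ((hm.mul' hm).mul' h1).mul' (hp.mul' hp)
  refine ⟨_, ((hF.const_mul i).sub (hF.mul_const' i)).mul_const' x₀', fun z => ?_⟩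
  simp [sliceDeriv, two_smul, mul_add, add_mul, mul_sub, sub_mul, mul_assoc]
  abel

end Analysis

/-! ### Conjugates of `i` by Cayley transforms. -/

section Cayley

variable {A : Type*} [Ring A]

/-- Moving `i` across exchanges `1 - z` and `1 + z`. For the Cayley transform `g = (1 + z)(1 - z)⁻¹`
this gives `g i g⁻¹ = g² i = i g⁻²`, so the squares `(1 - z)²` and `(1 + z)²` clear all denominators
and replace `g i g⁻¹` by `i`. -/
theorem mul_sq_cayley {i z g g' : A} (hz : i * z = -(z * i))
    (hg : g * (1 - z) = 1 + z) (hg' : (1 + z) * g' = 1 - z)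
    (hzg : g * z = z * g) (hzg' : g' * z = z * g') :
    (1 - z) * (1 - z) * (g * i * g') = i * ((1 - z) * (1 - z)) ∧
      (g * i * g') * ((1 + z) * (1 + z)) = (1 + z) * (1 + z) * i := by
  have h1 : i * (1 - z) = (1 + z) * i := by simp only [mul_sub, add_mul, hz]; noncomm_ring
  have h2 : i * (1 + z) = (1 - z) * i := by simp only [mul_add, sub_mul, hz]; noncomm_ring
  have c1 : g * (1 + z) = (1 + z) * g := by simp only [mul_add, add_mul, hzg]; noncomm_ring
  have c2 : g * (1 - z) = (1 - z) * g := by simp only [mul_sub, sub_mul, hzg]; noncomm_ring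
  have c3 : g' * (1 + z) = (1 + z) * g' := by simp only [mul_add, add_mul, hzg']; noncomm_ring
  have c4 : (1 - z) * (1 + z) = (1 + z) * (1 - z) := by noncomm_ring
  constructor
  · calc _ = (1 - z) * ((1 - z) * g) * i * g' := by simp only [mul_assoc]
      _ = (1 - z) * ((1 + z) * i) * g' := by rw [← c2, hg]; simp only [mul_assoc]
      _ = (1 + z) * ((1 - z) * i) * g' := by rw [← mul_assoc, c4, mul_assoc (1 + z)]
      _ = i * (1 - z) * ((1 + z) * g') := by rw [← h2, ← mul_assoc, ← h1, mul_assoc]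
      _ = _ := by rw [hg', mul_assoc]
  · calc _ = g * i * (g' * (1 + z)) * (1 + z) := by simp only [mul_assoc]
      _ = g * (i * (1 - z)) * (1 + z) := by rw [c3, hg']; simp only [mul_assoc]
      _ = g * ((1 + z) * (i * (1 + z))) := by rw [h1]; simp only [mul_assoc]
      _ = (g * (1 + z) * (1 - z)) * i := by rw [h2]; simp only [mul_assoc]
      _ = (1 + z) * (g * (1 - z)) * i := by rw [c1, mul_assoc (1 + z)]
      _ = _ := by rw [hg]

/-- As `z` is skew, `sharp` exchanges `1 - z` and `1 + z`; the Cayley transform is therefore unitary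
for `sharp`. -/
theorem cayley_transform {F : Type*} [FunLike F A A] [AddMonoidHomClass F A A] (sharp : F)
    (hmul : ∀ u v, sharp (u * v) = sharp v * sharp u) (hone : sharp 1 = 1)
    {z m p : A} (hz : sharp z = -z) (hm1 : (1 - z) * m = 1) (hm2 : m * (1 - z) = 1)
    (hp1 : (1 + z) * p = 1) (hp2 : p * (1 + z) = 1) :
    sharp ((1 + z) * m) = (1 - z) * p ∧ sharp ((1 - z) * p) = (1 + z) * m ∧
      ((1 + z) * m) * ((1 - z) * p) = 1 ∧ ((1 - z) * p) * ((1 + z) * m) = 1 ∧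
      (1 + z) * m * z = z * ((1 + z) * m) ∧ (1 - z) * p * z = z * ((1 - z) * p) := by
  have cm : m * z = z * m := by
    calc m * z = m * z * ((1 - z) * m) := by rw [hm1, mul_one]
      _ = m * (1 - z) * z * m := by noncomm_ring
      _ = z * m := by rw [hm2, one_mul]
  have cp : p * z = z * p := by
    calc p * z = p * z * ((1 + z) * p) := by rw [hp1, mul_one]
      _ = p * (1 + z) * z * p := by noncomm_ring
      _ = z * p := by rw [hp2, one_mul]
  have sm : sharp (1 - z) = 1 + z := by rw [map_sub, hone, hz, sub_neg_eq_add]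
  have sp : sharp (1 + z) = 1 - z := by rw [map_add, hone, hz, sub_eq_add_neg]
  have hsm : sharp m = p := by
    refine left_inv_eq_right_inv ?_ hp1
    rw [← sm, ← hmul, hm1, hone]
  have hsp : sharp p = m := by
    refine left_inv_eq_right_inv ?_ hm1
    rw [← sp, ← hmul, hp1, hone]
  have cm' : m * (1 + z) = (1 + z) * m := by rw [mul_add, cm, add_mul, mul_one, one_mul]
  have cp' : p * (1 - z) = (1 - z) * p := by rw [mul_sub, cp, sub_mul, mul_one, one_mul]
  refine ⟨?_, ?_, ?_, ?_, ?_, ?_⟩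
  · rw [hmul, hsm, sp, cp']
  · rw [hmul, hsp, sm, cm']
  · calc _ = (1 + z) * (m * (1 - z)) * p := by simp only [mul_assoc]
      _ = 1 := by rw [hm2, mul_one, hp1]
  · calc _ = (1 - z) * (p * (1 + z)) * m := by simp only [mul_assoc]
      _ = 1 := by rw [hp2, mul_one, hm1]
  · rw [mul_assoc, cm, ← mul_assoc, ← mul_assoc]; congr 1; noncomm_ring
  · rw [mul_assoc, cp, ← mul_assoc, ← mul_assoc]; congr 1; noncomm_ring

end Cayley

/-! ### The linear system for the defect of a conjugate of `i`. -/

section Rigidity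

variable {A : Type*} [NormedRing A] [NormedAlgebra ℝ A]

/-- Bracketing with `i` doubles an element anticommuting with `i`, so the derivative at `z` is `4 i
(x z - z x) x'`. Substituting `i z / 4` and using `i² = -1` makes it an honest coboundary: the slice
map differentiates onto the coboundaries. -/
theorem sliceDeriv_smul_mul {sharp : A →ₗ[ℝ] A} {i x x' z : A} (hi : i * i = -1)
    (hx : x * x' = 1) (hx' : x' * x = 1) (hix : i * x = x * i) (hz : z ∈ skewAnti sharp i) :
    sliceDeriv i x x' ((1 / 4 : ℝ) • (i * z)) = z - x * z * x' := by
  have hix' : i * x' = x' * i := by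
    calc i * x' = x' * (x * i) * x' := by rw [← mul_assoc, hx', one_mul]
      _ = x' * i * (x * x') := by rw [← hix]; simp only [mul_assoc]
      _ = _ := by rw [hx, mul_one]
  have e : sliceDeriv i x x' (i * z) = (4 : ℕ) • (z - x * z * x') := by
    have hzi : z * i = -(i * z) := by rw [hz.1, neg_neg]
    have e1 : i * (x * (i * z)) * x' = -(x * z * x') := by
      calc _ = (i * x) * i * z * x' := by simp only [mul_assoc]
        _ = x * (i * i) * z * x' := by rw [hix]; simp only [mul_assoc]
        _ = _ := by rw [hi]; simp only [mul_neg, mul_one, neg_mul]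
    have e2 : i * (i * z * x) * x' = -z := by
      calc _ = (i * i) * z * (x * x') := by simp only [mul_assoc]
        _ = _ := by rw [hi, hx]; simp
    have e3 : x * (i * z) * i * x' = x * z * x' := by
      calc _ = x * i * (z * i) * x' := by simp only [mul_assoc]
        _ = -(x * (i * i) * z * x') := by rw [hzi]; simp only [mul_assoc, mul_neg, neg_mul]
        _ = _ := by rw [hi]; simp only [mul_neg, mul_one, neg_mul, neg_neg]
    have e4 : i * z * x * i * x' = z := by
      calc _ = i * (z * (x * i)) * x' := by simp only [mul_assoc]
        _ = i * (z * i) * (x * x') := by rw [← hix]; simp only [mul_assoc]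
        _ = -((i * i) * z) := by rw [hzi, hx]; simp only [mul_assoc, mul_neg, mul_one]
        _ = _ := by rw [hi]; simp
    have : sliceDeriv i x x' (i * z) = (2 : ℕ) • (i * (x * (i * z)) * x' - i * (i * z * x) * x'
        - (x * (i * z) * i * x' - i * z * x * i * x')) := by
      simp only [sliceDeriv, LinearMap.coe_mk, AddHom.coe_mk, mul_smul_comm, smul_mul_assoc,
        ← smul_sub, mul_sub, sub_mul]
    rw [this, e1, e2, e3, e4]
    abel
  rw [map_smul, e, ← Nat.cast_smul_eq_nsmul ℝ, smul_smul]
  norm_num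

/-- The linear system satisfied by the pair `c` of values at `a`, `b` of the coboundary of a
conjugate of `i`, for parameters `p = (x, x', y, y', z, c₁, c₂)`. -/
noncomputable def linSystem (sharp : A →ₗ[ℝ] A) (i x₀' y₀' : A) (pr : A × A →ₗ[ℝ] skewAnti sharp i)
    (p : A × A × A × A × A × A × A) :
    A × A →ₗ[ℝ] A × skewAnti sharp i × A × A × A × A :=
  let x := p.1
  let x' := p.2.1
  let y := p.2.2.1
  let y' := p.2.2.2.1
  let z := p.2.2.2.2.1
  let c₁ := p.2.2.2.2.2.1
  let c₂ := p.2.2.2.2.2.2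
  -- For `k = g i g⁻¹`, with `g` the Cayley transform of `z`, one has `m k = i m` and `k q = q i`.
  -- The third and fourth components below are thus `m (k c + c k - c₁ c) q`, with the quadratic
  -- term linearized by the parameter `c₁`.
  let m := (1 - z) * (1 - z)
  let q := (1 + z) * (1 + z)
  { toFun := fun c =>
      (foxRelation x x' y y' c.1 c.2, pr (m * c.1 * x * q * x₀', m * c.2 * y * q * y₀'),
        i * m * c.1 * q + m * c.1 * q * i - m * c₁ * c.1 * q,
        i * m * c.2 * q + m * c.2 * q * i - m * c₂ * c.2 * q,
        c.1 + sharp c.1, c.2 + sharp c.2)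
    map_add' := by
      intro c d
      refine Prod.ext ?_ (Prod.ext ?_ (Prod.ext ?_ (Prod.ext ?_ (Prod.ext ?_ ?_))))
      · simp only [foxRelation, cocycleWord, Prod.fst_add, Prod.snd_add, mul_add, add_mul,
          neg_add, mul_sub, sub_mul, mul_neg, neg_mul]
        abel
      · simp only [Prod.fst_add, Prod.snd_add, mul_add, add_mul, ← map_add, Prod.mk_add_mk]
      · simp only [Prod.fst_add, Prod.snd_add, mul_add, add_mul]; abel
      · simp only [Prod.fst_add, Prod.snd_add, mul_add, add_mul]; abel
      · simp only [Prod.fst_add, Prod.snd_add, map_add]; abel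
      · simp only [Prod.snd_add, map_add]; abel
    map_smul' := by
      intro r c
      refine Prod.ext ?_ (Prod.ext ?_ (Prod.ext ?_ (Prod.ext ?_ (Prod.ext ?_ ?_))))
      · simp only [foxRelation, cocycleWord, Prod.smul_fst, Prod.smul_snd, mul_smul_comm,
          smul_mul_assoc, ← smul_neg, ← smul_sub, ← smul_add, RingHom.id_apply]
      · simp only [Prod.smul_fst, Prod.smul_snd, mul_smul_comm, smul_mul_assoc, ← Prod.smul_mk,
          map_smul, RingHom.id_apply]
      · simp only [Prod.smul_fst, Prod.smul_snd, mul_smul_comm, smul_mul_assoc, ← smul_sub,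
          ← smul_add, RingHom.id_apply]
      · simp only [Prod.smul_fst, Prod.smul_snd, mul_smul_comm, smul_mul_assoc, ← smul_sub,
          ← smul_add, RingHom.id_apply]
      · simp only [Prod.smul_fst, Prod.smul_snd, map_smul, ← smul_add, RingHom.id_apply]
      · simp only [Prod.smul_snd, map_smul, ← smul_add, RingHom.id_apply] }

variable [FiniteDimensional ℝ A]

/-- The system depends continuously on its parameters, and the injective maps form an open set of
linear maps in finite dimension. -/
theorem eventually_injective_linSystem (sharp : A →ₗ[ℝ] A) (i x₀' y₀' : A)
    (pr : A × A →ₗ[ℝ] skewAnti sharp i) (p : A × A × A × A × A × A × A)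
    (hp : Function.Injective (linSystem sharp i x₀' y₀' pr p)) :
    ∀ᶠ q in 𝓝 p, Function.Injective (linSystem sharp i x₀' y₀' pr q) := by
  have hpr : Continuous pr := LinearMap.continuous_of_finiteDimensional pr
  have hc : Continuous fun q => (linSystem sharp i x₀' y₀' pr q).toContinuousLinearMap := by
    rw [continuous_clm_apply]
    intro c
    simp only [LinearMap.coe_toContinuousLinearMap', linSystem, foxRelation, cocycleWord,
      LinearMap.coe_mk, AddHom.coe_mk]
    fun_prop
  have := hc.continuousAt.preimage_mem_nhds
    (ContinuousLinearMap.isOpen_injective.mem_nhds (x := (linSystem sharp i x₀' y₀' pr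
      p).toContinuousLinearMap) hp)
  exact this

omit [FiniteDimensional ℝ A] in
-- At the base parameters the system says that `(c, d)` is a cocycle with values in `skewAnti` and
-- that `pr (c, d) = 0`. By `H1` it is the coboundary of some `z`, that is, the slice derivative at
-- `i z / 4`; since `pr` inverts that derivative, `i z = 0`.
theorem injective_linSystem_base {sharp : A →ₗ[ℝ] A} {i x x' y y' : A} (hi : i * i = -1)
    (hi' : sharp i = -i) (hmul : ∀ u v, sharp (u * v) = sharp v * sharp u)
    (hx : x * x' = 1) (hx' : x' * x = 1) (hy : y * y' = 1) (hy' : y' * y = 1)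
    (hix : i * x = x * i) (hiy : i * y = y * i)
    (H1 : ∀ c ∈ skewAnti sharp i, ∀ d ∈ skewAnti sharp i, foxRelation x x' y y' c d = 0 →
      ∃ z ∈ skewAnti sharp i, c = z - x * z * x' ∧ d = z - y * z * y')
    (pr : A × A →ₗ[ℝ] skewAnti sharp i)
    (hpr : ∀ z : skewAnti sharp i, pr (sliceDeriv i x x' z, sliceDeriv i y y' z) = z) :
    Function.Injective (linSystem sharp i x' y' pr (x, x', y, y', 0, 0, 0)) := by
  rw [injective_iff_map_eq_zero]
  rintro ⟨c, d⟩ h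
  simp only [linSystem, LinearMap.coe_mk, AddHom.coe_mk, Prod.mk_eq_zero, sub_zero, add_zero,
    mul_one, one_mul, zero_mul, mul_zero, mul_assoc, hx, hy] at h
  obtain ⟨h1, h2, h3, h4, h5, h6⟩ := h
  obtain ⟨z, hz, hc, hd⟩ := H1 c ⟨eq_neg_of_add_eq_zero_left h3, eq_neg_of_add_eq_zero_right h5⟩
    d ⟨eq_neg_of_add_eq_zero_left h4, eq_neg_of_add_eq_zero_right h6⟩ h1
  have hiz : (1 / 4 : ℝ) • (i * z) ∈ skewAnti sharp i := by
    refine Submodule.smul_mem _ _ ⟨?_, ?_⟩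
    · rw [hz.1, mul_neg, ← mul_assoc, hz.1, neg_mul]
    · rw [hmul, hi', hz.2, neg_mul_neg, hz.1, neg_neg]
  have h7 := hpr ⟨_, hiz⟩
  simp only [sliceDeriv_smul_mul hi hx hx' hix hz, sliceDeriv_smul_mul hi hy hy' hiy hz, ← hc,
    ← hd, h2] at h7
  have h8 : (1 / 4 : ℝ) • (i * z) = 0 := (congrArg Subtype.val h7).symm
  have h9 : i * z = 0 := (smul_eq_zero.1 h8).resolve_left (by norm_num)
  have h10 : z = 0 := by
    rw [← neg_eq_zero, ← neg_one_mul, ← hi, mul_assoc, h9, mul_zero]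
  simp [hc, hd, h10]

end Rigidity

/-! ### From vanishing cohomology to local rigidity. -/

section Rigidity

variable {A : Type*} [NormedRing A] [NormedAlgebra ℝ A] [FiniteDimensional ℝ A]

/-- The derivative is block triangular with identity diagonal blocks, hence onto, and the map is
locally open. This is the implicit function theorem for the slice condition: each nearby pair admits
a small `z` attaining any prescribed nearby value. -/
theorem map_nhds_slice {sharp : A →ₗ[ℝ] A} {i x y x' y' : A}
    (pr : A × A →ₗ[ℝ] skewAnti sharp i)
    (hpr : ∀ z : skewAnti sharp i, pr (sliceDeriv i x x' z, sliceDeriv i y y' z) = z) :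
    Filter.map (fun q : (A × A) × skewAnti sharp i =>
      (q.1, pr (sliceEntry i x' q.1.1 q.2, sliceEntry i y' q.1.2 q.2))) (𝓝 ((x, y), 0)) =
      𝓝 ((x, y), pr (sliceEntry i x' x 0, sliceEntry i y' y 0)) := by
  have : CompleteSpace A := FiniteDimensional.complete ℝ A
  have : CompleteSpace (skewAnti sharp i) := FiniteDimensional.complete ℝ _
  obtain ⟨f, hf, hf'⟩ := exists_hasStrictFDerivAt_sliceEntry i x x'
  obtain ⟨g, hg, hg'⟩ := exists_hasStrictFDerivAt_sliceEntry i y y'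
  let prc := pr.toContinuousLinearMap
  have h0 := (ContinuousLinearMap.hasStrictFDerivAt ((skewAnti sharp i).subtypeL.comp
    (ContinuousLinearMap.snd ℝ (A × A) _)) (x := ((x, y), (0 : skewAnti sharp i))))
  have h01 := (ContinuousLinearMap.hasStrictFDerivAt ((ContinuousLinearMap.fst ℝ A A).comp
    (ContinuousLinearMap.fst ℝ (A × A) _)) (x := ((x, y), (0 : skewAnti sharp i))))
  have h02 := (ContinuousLinearMap.hasStrictFDerivAt ((ContinuousLinearMap.snd ℝ A A).comp
    (ContinuousLinearMap.fst ℝ (A × A) _)) (x := ((x, y), (0 : skewAnti sharp i))))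
  have h1 : HasStrictFDerivAt (fun q : (A × A) × skewAnti sharp i => (q.1.1, (q.2 : A)))
      (((ContinuousLinearMap.fst ℝ A A).comp (ContinuousLinearMap.fst ℝ (A × A) _)).prod
        ((skewAnti sharp i).subtypeL.comp (ContinuousLinearMap.snd ℝ (A × A) _)))
      ((x, y), 0) := h01.prodMk h0
  have h2 : HasStrictFDerivAt (fun q : (A × A) × skewAnti sharp i => (q.1.2, (q.2 : A)))
      (((ContinuousLinearMap.snd ℝ A A).comp (ContinuousLinearMap.fst ℝ (A × A) _)).prod
        ((skewAnti sharp i).subtypeL.comp (ContinuousLinearMap.snd ℝ (A × A) _)))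
      ((x, y), 0) := h02.prodMk h0
  have h3 := HasStrictFDerivAt.comp (g := fun p : A × A => sliceEntry i x' p.1 p.2)
    ((x, y), (0 : skewAnti sharp i)) hf h1
  have h4 := HasStrictFDerivAt.comp (g := fun p : A × A => sliceEntry i y' p.1 p.2)
    ((x, y), (0 : skewAnti sharp i)) hg h2
  have h5 := (hasStrictFDerivAt_fst (𝕜 := ℝ) (p := ((x, y), (0 : skewAnti sharp i)))).prodMk
    (prc.hasStrictFDerivAt.comp ((x, y), (0 : skewAnti sharp i)) (h3.prodMk h4))
  refine h5.map_nhds_eq_of_surj ?_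
  rw [LinearMap.range_eq_top]
  rintro ⟨u, v⟩
  let L : (A × A) × skewAnti sharp i →L[ℝ] skewAnti sharp i := prc.comp
    ((f.comp (((ContinuousLinearMap.fst ℝ A A).comp (ContinuousLinearMap.fst ℝ (A × A) _)).prod
        ((skewAnti sharp i).subtypeL.comp (ContinuousLinearMap.snd ℝ (A × A) _)))).prod
      (g.comp (((ContinuousLinearMap.snd ℝ A A).comp (ContinuousLinearMap.fst ℝ (A × A) _)).prod
        ((skewAnti sharp i).subtypeL.comp (ContinuousLinearMap.snd ℝ (A × A) _)))))
  have hL (z) : L (0, z) = z := by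
    simp only [L, ContinuousLinearMap.comp_apply, ContinuousLinearMap.prod_apply,
      ContinuousLinearMap.coe_fst', ContinuousLinearMap.coe_snd', Prod.fst_zero, Prod.snd_zero,
      hf', hg', Submodule.subtypeL_apply]
    exact hpr z
  refine ⟨(u, v - L (u, 0)), Prod.ext rfl ?_⟩
  change L (u, v - L (u, 0)) = v
  have : (u, v - L (u, 0)) = (u, (0 : skewAnti sharp i)) + (0, v - L (u, 0)) := by simp
  rw [this, map_add, hL]
  abel

/-- If the twisted cohomology of the group in the complement of the centralizer of `i` vanishes
at `(x₀, y₀)`, then all nearby representations can be conjugated into the centralizer of `i`. -/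
theorem eventually_exists_conj_commute (sharp : A →ₗ[ℝ] A)
    (hmul : ∀ u v, sharp (u * v) = sharp v * sharp u) (hone : sharp 1 = 1)
    (hinv : ∀ u, sharp (sharp u) = u)
    {i x₀ y₀ : A} (hi : i * i = -1) (hi' : sharp i = -i)
    (hx : x₀ * sharp x₀ = 1) (hx' : sharp x₀ * x₀ = 1)
    (hy : y₀ * sharp y₀ = 1) (hy' : sharp y₀ * y₀ = 1)
    (hix : i * x₀ = x₀ * i) (hiy : i * y₀ = y₀ * i)
    (H0 : ∀ z ∈ skewAnti sharp i, x₀ * z = z * x₀ → y₀ * z = z * y₀ → z = 0)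
    (H1 : ∀ c ∈ skewAnti sharp i, ∀ d ∈ skewAnti sharp i,
      foxRelation x₀ (sharp x₀) y₀ (sharp y₀) c d = 0 →
      ∃ z ∈ skewAnti sharp i, c = z - x₀ * z * sharp x₀ ∧ d = z - y₀ * z * sharp y₀) :
    ∀ᶠ p : A × A in 𝓝 (x₀, y₀), p.1 * sharp p.1 = 1 → sharp p.1 * p.1 = 1 →
      p.2 * sharp p.2 = 1 → sharp p.2 * p.2 = 1 →
      sharp p.2 * p.1 * p.2 * sharp p.1 * p.2 = p.1 * (sharp p.2 * p.1 * p.2 * sharp p.1) →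
      ∃ g : A, g * sharp g = 1 ∧ sharp g * g = 1 ∧
        i * (sharp g * p.1 * g) = sharp g * p.1 * g * i ∧
        i * (sharp g * p.2 * g) = sharp g * p.2 * g * i := by
  have : CompleteSpace A := FiniteDimensional.complete ℝ A
  have hsharp : Continuous sharp := LinearMap.continuous_of_finiteDimensional sharp
  -- a projection onto the coboundaries
  let β : skewAnti sharp i →ₗ[ℝ] A × A :=
    ((sliceDeriv i x₀ (sharp x₀)).prod (sliceDeriv i y₀ (sharp y₀))).comp
      (skewAnti sharp i).subtype
  have hβ : Function.Injective β := by
    -- The commutator `w` of `u` and `z` anticommutes with `i`, so the vanishing of `i (2w) - (2w)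
    -- i` means `4 i w = 0`. Thus the kernel of `β` consists of invariants, which `H0` excludes.
    have key (u u' : A) (hu' : u' * u = 1) (hiu : i * u = u * i)
        (z : A) (hz : z ∈ skewAnti sharp i) (h : sliceDeriv i u u' z = 0) : u * z = z * u := by
      set w := u * z - z * u with hw
      have hiw : i * w = -(w * i) := by
        rw [hw, mul_sub, sub_mul, ← mul_assoc, hiu, mul_assoc, hz.1, mul_assoc z, ← hiu,
          ← mul_assoc i, hz.1]
        noncomm_ring
      have h1 : i * (2 • w) - (2 • w) * i = 0 := by
        have h2 := congrArg (· * u) h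
        simpa only [sliceDeriv, LinearMap.coe_mk, AddHom.coe_mk, mul_assoc, hu', mul_one,
          zero_mul] using h2
      have h2 : (4 : ℝ) • (i * w) = 0 := by
        have h3 : w * i = -(i * w) := by rw [hiw, neg_neg]
        rw [mul_smul_comm, smul_mul_assoc, h3] at h1
        rw [← h1]; module
      have h3 : i * w = 0 := (smul_eq_zero.1 h2).resolve_left (by norm_num)
      have h4 : w = 0 := by rw [← neg_eq_zero, ← neg_one_mul, ← hi, mul_assoc, h3, mul_zero]
      exact sub_eq_zero.1 h4
    rw [injective_iff_map_eq_zero]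
    intro z hz
    have hz' := Prod.mk_eq_zero.1 hz
    exact Subtype.ext (H0 z z.2 (key x₀ _ hx' hix z z.2 hz'.1) (key y₀ _ hy' hiy z z.2 hz'.2))
  obtain ⟨pr, hpr⟩ := β.exists_leftInverse_of_injective (LinearMap.ker_eq_bot.2 hβ)
  have hpr' (z : skewAnti sharp i) :
      pr (sliceDeriv i x₀ (sharp x₀) z, sliceDeriv i y₀ (sharp y₀) z) = z :=
    LinearMap.congr_fun hpr z
  -- the linear system is injective near the base point
  have hT := eventually_injective_linSystem sharp i (sharp x₀) (sharp y₀) pr _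
    (injective_linSystem_base hi hi' hmul hx hx' hy hy' hix hiy H1 pr hpr')
  -- `Ring.inverse` is zero off the units; this is harmless, as only continuity at `0` is used and
  -- `1 ± z` are units nearby.
  let K : A → A := fun z =>
    ((1 + z) * Ring.inverse (1 - z)) * i * ((1 - z) * Ring.inverse (1 + z))
  have hinv1 : ContinuousAt (fun z : A => Ring.inverse (1 - z)) 0 := by
    refine ContinuousAt.comp (g := Ring.inverse) ?_ (by fun_prop)
    simpa using NormedRing.inverse_continuousAt (1 : Aˣ)
  have hinv2 : ContinuousAt (fun z : A => Ring.inverse (1 + z)) 0 := by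
    refine ContinuousAt.comp (g := Ring.inverse) ?_ (by fun_prop)
    simpa using NormedRing.inverse_continuousAt (1 : Aˣ)
  have hK : ContinuousAt K 0 := by
    refine ContinuousAt.mul (ContinuousAt.mul (ContinuousAt.mul ?_ hinv1) ?_)
      (ContinuousAt.mul ?_ hinv2) <;> fun_prop
  have hK0 : K 0 = i := by simp [K]
  let Φ : (A × A) × skewAnti sharp i → A × A × A × A × A × A × A := fun q =>
    (q.1.1, sharp q.1.1, q.1.2, sharp q.1.2, q.2, K q.2 - q.1.1 * K q.2 * sharp q.1.1,
      K q.2 - q.1.2 * K q.2 * sharp q.1.2)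
  have hΦ : ContinuousAt Φ ((x₀, y₀), 0) := by
    have hK' : ContinuousAt (fun q : (A × A) × skewAnti sharp i => K q.2) ((x₀, y₀), 0) :=
      ContinuousAt.comp (g := K) hK (by fun_prop)
    have a1 : ContinuousAt (fun q : (A × A) × skewAnti sharp i => q.1.1) ((x₀, y₀), 0) := by
      fun_prop
    have a2 : ContinuousAt (fun q : (A × A) × skewAnti sharp i => q.1.2) ((x₀, y₀), 0) := by
      fun_prop
    have a3 := hsharp.continuousAt.comp a1
    have a4 := hsharp.continuousAt.comp a2
    exact a1.prodMk (a3.prodMk (a2.prodMk (a4.prodMk ((by fun_prop : ContinuousAt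
      (fun q : (A × A) × skewAnti sharp i => (q.2 : A)) ((x₀, y₀), 0)).prodMk
      ((hK'.sub ((a1.mul hK').mul a3)).prodMk (hK'.sub ((a2.mul hK').mul a4)))))))
  have hΦ0 : Φ ((x₀, y₀), 0) = (x₀, sharp x₀, y₀, sharp y₀, 0, 0, 0) := by
    have e1 : x₀ * i * sharp x₀ = i := by rw [← hix, mul_assoc, hx, mul_one]
    have e2 : y₀ * i * sharp y₀ = i := by rw [← hiy, mul_assoc, hy, mul_one]
    simp only [Φ, Submodule.coe_zero, hK0, e1, e2, sub_self]
  rw [← hΦ0] at hT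
  have hu1 : ∀ᶠ q : (A × A) × skewAnti sharp i in 𝓝 ((x₀, y₀), 0), IsUnit (1 - (q.2 : A)) := by
    have hc : Continuous fun q : (A × A) × skewAnti sharp i => 1 - (q.2 : A) := by fun_prop
    exact hc.continuousAt.eventually (Units.isOpen.mem_nhds (by simp))
  have hu2 : ∀ᶠ q : (A × A) × skewAnti sharp i in 𝓝 ((x₀, y₀), 0), IsUnit (1 + (q.2 : A)) := by
    have hc : Continuous fun q : (A × A) × skewAnti sharp i => 1 + (q.2 : A) := by fun_prop
    exact hc.continuousAt.eventually (Units.isOpen.mem_nhds (by simp))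
  have hgood := (hΦ.eventually hT).and (hu1.and hu2)
  have himg := Filter.image_mem_map (m := fun q : (A × A) × skewAnti sharp i =>
      (q.1, pr (sliceEntry i (sharp x₀) q.1.1 q.2, sliceEntry i (sharp y₀) q.1.2 q.2))) hgood
  rw [map_nhds_slice pr hpr'] at himg
  have hz0 : pr (sliceEntry i (sharp x₀) x₀ 0, sliceEntry i (sharp y₀) y₀ 0) = 0 := by
    have : (sliceEntry i (sharp x₀) x₀ 0, sliceEntry i (sharp y₀) y₀ 0) = (0 : A × A) := by
      simp [sliceEntry, hix, hiy]
    rw [this, map_zero]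
  rw [hz0] at himg
  have hcont : ContinuousAt (fun p : A × A => (p, (0 : skewAnti sharp i))) (x₀, y₀) := by
    fun_prop
  -- For `p` near the base, `(p, 0)` lies in the image of the good set: some small `z` satisfies the
  -- slice condition while the linear system stays injective.
  filter_upwards [hcont himg] with p hp hp1 hp1' hp2 hp2' hrel
  obtain ⟨⟨⟨x, y⟩, z⟩, ⟨hinj, hm, hq⟩, hzeq⟩ := hp
  obtain ⟨rfl, hslice⟩ := Prod.mk.inj hzeq
  simp only at hp1 hp1' hp2 hp2' hrel hslice hm hq
  obtain ⟨⟨ζ, hζ⟩, hζ'⟩ : ∃ w : skewAnti sharp i, w = z := ⟨z, rfl⟩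
  subst hζ'
  obtain ⟨hz, hzs⟩ := hζ
  have hm1 := Ring.mul_inverse_cancel _ hm
  have hm2 := Ring.inverse_mul_cancel _ hm
  have hq1 := Ring.mul_inverse_cancel _ hq
  have hq2 := Ring.inverse_mul_cancel _ hq
  obtain ⟨hg, hg', hgg', hg'g, hgz, hg'z⟩ := cayley_transform sharp hmul hone hzs hm1 hm2 hq1 hq2
  simp only [Φ, K] at hinj
  have hgm : (1 + ζ) * Ring.inverse (1 - ζ) * (1 - ζ) = 1 + ζ := by
    rw [mul_assoc, hm2, mul_one]
  have hqg : (1 + ζ) * ((1 - ζ) * Ring.inverse (1 + ζ)) = 1 - ζ := by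
    rw [← mul_assoc, show (1 + ζ) * (1 - ζ) = (1 - ζ) * (1 + ζ) by noncomm_ring, mul_assoc, hq1,
      mul_one]
  set g := (1 + ζ) * Ring.inverse (1 - ζ) with hgdef
  set g' := (1 - ζ) * Ring.inverse (1 + ζ) with hg'def
  obtain ⟨hk1, hk2⟩ := mul_sq_cayley hz hgm hqg hgz hg'z
  set k := g * i * g' with hk
  have hkk : k * k = -1 := by
    calc k * k = g * i * (g' * g) * i * g' := by simp only [hk, mul_assoc]
      _ = g * (i * i) * g' := by rw [hg'g]; simp only [mul_assoc, one_mul]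
      _ = -1 := by rw [hi]; simp [hgg']
  have hks : sharp k = -k := by
    rw [hk, hmul (g * i) g', hmul g i, hg, hg', hi']
    simp only [mul_neg, neg_mul, mul_assoc]
  clear_value k
  -- The identity `k c + c k = c²`, multiplied by the two squares: the linearized equation with its
  -- parameter set to the actual `c`.
  have hsq (u u' : A) (hu : u * u' = 1) (hu' : u' * u = 1) :
      i * ((1 - ζ) * (1 - ζ)) * (k - u * k * u') * ((1 + ζ) * (1 + ζ))
        + (1 - ζ) * (1 - ζ) * (k - u * k * u') * ((1 + ζ) * (1 + ζ)) * i
        - (1 - ζ) * (1 - ζ) * (k - u * k * u') * (k - u * k * u') * ((1 + ζ) * (1 + ζ)) = 0 := by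
    have hl : u * k * u' * (u * k * u') = -1 := by
      calc _ = u * k * (u' * u) * k * u' := by simp only [mul_assoc]
        _ = u * (k * k) * u' := by rw [hu']; simp only [mul_assoc, one_mul]
        _ = -1 := by rw [hkk]; simp [hu]
    have h := mul_sub_add_sub_mul_of_sq_eq_neg_one hkk hl
    set c := k - u * k * u'
    calc _ = (1 - ζ) * (1 - ζ) * (k * c + c * k - c * c) * ((1 + ζ) * (1 + ζ)) := by
          rw [← hk1, mul_assoc _ _ i, ← hk2]
          generalize (1 - ζ) * (1 - ζ) = m
          generalize (1 + ζ) * (1 + ζ) = q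
          simp only [mul_add, mul_sub, add_mul, sub_mul, mul_assoc]
      _ = 0 := by rw [h]; simp
  have hskew (u : A) : k - u * k * sharp u + sharp (k - u * k * sharp u) = 0 := by
    rw [map_sub, hmul, hmul u k, hinv, hks]
    simp only [mul_neg, neg_mul, mul_assoc]
    abel
  have hentry (u u₀' : A) (hu' : sharp u * u = 1) :
      (1 - ζ) * (1 - ζ) * (k - u * k * sharp u) * u * ((1 + ζ) * (1 + ζ)) * u₀' =
        sliceEntry i u₀' u ζ := by
    have h : (k - u * k * sharp u) * u = k * u - u * k := by
      rw [sub_mul, mul_assoc _ _ u, hu', mul_one]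
    rw [mul_assoc _ _ u, h, sliceEntry]
    congr 1
    calc _ = (1 - ζ) * (1 - ζ) * k * u * ((1 + ζ) * (1 + ζ))
          - (1 - ζ) * (1 - ζ) * u * (k * ((1 + ζ) * (1 + ζ))) := by
          simp only [mul_sub, sub_mul, mul_assoc]
      _ = _ := by rw [hk1, hk2]; simp only [mul_assoc]
  -- Every component of the linear system vanishes on the defect, which is therefore zero: `k`
  -- commutes with `x` and `y`.
  have hzero := (injective_iff_map_eq_zero _).1 hinj (k - x * k * sharp x, k - y * k * sharp y) (by
    simp only [linSystem, LinearMap.coe_mk, AddHom.coe_mk,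
      foxRelation_coboundary hp1 hp1' hp2 hp2' hrel, hskew, hsq x _ hp1 hp1', hsq y _ hp2 hp2',
      hentry x _ hp1', hentry y _ hp2', hslice, Prod.mk_zero_zero])
  obtain ⟨hcx, hcy⟩ := Prod.mk_eq_zero.1 hzero
  have hfin (u : A) (hu' : sharp u * u = 1) (hc : k - u * k * sharp u = 0) :
      i * (g' * u * g) = g' * u * g * i := by
    have hku : k * u = u * k := by
      rw [sub_eq_zero.1 hc, mul_assoc _ _ u, hu', mul_one, ← sub_eq_zero.1 hc]
    calc i * (g' * u * g) = (g' * g) * i * g' * u * g := by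
          rw [hg'g, one_mul]; simp only [mul_assoc]
      _ = g' * (k * u) * g := by simp only [hk, mul_assoc]
      _ = g' * u * g * i * (g' * g) := by rw [hku]; simp only [hk, mul_assoc]
      _ = _ := by rw [hg'g, mul_one]
  refine ⟨g, ?_, ?_, ?_, ?_⟩ <;> rw [hg]
  · exact hgg'
  · exact hg'g
  · exact hfin x hp1' hcx
  · exact hfin y hp2' hcy

end Rigidity

/-! ### Cohomology of `ρ₀` in the symmetric square of ℂ³. -/

/-- A symmetric complex `3 × 3` matrix given by its entries. -/
def symMat (u₀ u₁ u₂ u₃ u₄ u₅ : ℂ) : Matrix (Fin 3) (Fin 3) ℂ :=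
  !![u₀, u₁, u₂; u₁, u₃, u₄; u₂, u₄, u₅]

theorem exists_eq_symMat {s : Matrix (Fin 3) (Fin 3) ℂ} (hs : sᵀ = s) :
    ∃ u₀ u₁ u₂ u₃ u₄ u₅, s = symMat u₀ u₁ u₂ u₃ u₄ u₅ := by
  refine ⟨s 0 0, s 0 1, s 0 2, s 1 1, s 1 2, s 2 2, ?_⟩
  have h (i j) : s j i = s i j := congrFun (congrFun hs i) j
  ext i j
  fin_cases i <;> fin_cases j <;> simp [symMat, h 0 1, h 0 2, h 1 2]

theorem transpose_symMat (u₀ u₁ u₂ u₃ u₄ u₅ : ℂ) :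
    (symMat u₀ u₁ u₂ u₃ u₄ u₅)ᵀ = symMat u₀ u₁ u₂ u₃ u₄ u₅ := by
  ext i j
  fin_cases i <;> fin_cases j <;> rfl

/-- The matrix of `ρ₀(b⁻¹a)`. -/
noncomputable def matBinvA : Matrix (Fin 3) (Fin 3) ℂ :=
  !![1, 1, eis; -1, 0, -1 - eis; -1 - eis, -eis, 1]

/-- The matrix of `ρ₀(b⁻¹aba⁻¹)`. -/
noncomputable def matW : Matrix (Fin 3) (Fin 3) ℂ :=
  !![1 - eis, 0, -1 - eis; 0, 1 + eis, 0; -1 - eis, 0, 0]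

theorem matBinv_mul_matA : matBinv * matA = matBinvA := by
  ext i j
  fin_cases i <;> fin_cases j <;>
    simp [matA, matBinv, matBinvA, Matrix.mul_apply, Fin.sum_univ_three] <;> grind [eis_sq]

theorem matB_mul_matAinv : matB * matAinv = !![1, -1, -1 - eis; 1, 0, -eis; eis, -1 - eis, 1] := by
  ext i j
  fin_cases i <;> fin_cases j <;>
    simp [matB, matAinv, Matrix.mul_apply, Fin.sum_univ_three] <;> grind [eis_sq]

theorem matBinvA_mul_matB_mul_matAinv : matBinvA * (matB * matAinv) = matW := by
  rw [matB_mul_matAinv]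
  ext i j
  fin_cases i <;> fin_cases j <;>
    simp [matW, matBinvA, Matrix.mul_apply, Fin.sum_univ_three] <;> grind [eis_sq]

/-- This and the next four tables write the action on the six coordinates, with coefficients reduced
by `eis_sq` to degree one in `eis`. -/
theorem matBinv_conj_symMat (u₀ u₁ u₂ u₃ u₄ u₅ : ℂ) :
    matBinv * symMat u₀ u₁ u₂ u₃ u₄ u₅ * matBinvᵀ = symMat
      (u₀)
      (-u₀ + u₁)
      (((-1) - eis)*u₀ + u₁ + u₂)
      (u₀ + (-2)*u₁ + u₃)
      ((1 + eis)*u₀ + ((-2) - eis)*u₁ - u₂ + u₃ + u₄)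
      (eis*u₀ + ((-2) + (-2)*eis)*u₁ + ((-2) + (-2)*eis)*u₂ + u₃ + 2*u₄ + u₅) := by
  ext i j
  fin_cases i <;> fin_cases j <;>
    simp [matBinv, symMat, Matrix.mul_apply, Fin.sum_univ_three]
  any_goals ring1
  linear_combination (u₀) * eis_sq

theorem matBinvA_conj_symMat (u₀ u₁ u₂ u₃ u₄ u₅ : ℂ) :
    matBinvA * symMat u₀ u₁ u₂ u₃ u₄ u₅ * matBinvAᵀ = symMat
      (u₀ + 2*u₁ + (2)*eis*u₂ + u₃ + (2)*eis*u₄ + ((-1) - eis)*u₅)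
      (-u₀ - u₁ + ((-1) + (-2)*eis)*u₂ + ((-1) - eis)*u₄ + u₅)
      (((-1) - eis)*u₀ + ((-1) + (-2)*eis)*u₁ + 2*u₂ - eis*u₃ + (2 + eis)*u₄ + eis*u₅)
      (u₀ + (2 + (2)*eis)*u₂ + eis*u₅)
      ((1 + eis)*u₀ + eis*u₁ + ((-1) + eis)*u₂ - u₄ + ((-1) - eis)*u₅)
      (eis*u₀ + (-2)*u₁ + ((-2) + (-2)*eis)*u₂ + ((-1) - eis)*u₃ + (-2)*eis*u₄ + u₅) := by
  ext i j
  fin_cases i <;> fin_cases j <;>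
    simp [matBinvA, symMat, Matrix.mul_apply, Fin.sum_univ_three]
  · linear_combination (u₅) * eis_sq
  · linear_combination (-u₅) * eis_sq
  · linear_combination (-u₂ - u₄) * eis_sq
  · linear_combination (-u₅) * eis_sq
  · linear_combination (u₅) * eis_sq
  · linear_combination (u₂ + u₄) * eis_sq
  · linear_combination (-u₂ - u₄) * eis_sq
  · linear_combination (u₂ + u₄) * eis_sq
  · linear_combination (u₀ + 2*u₁ + u₃) * eis_sq

theorem matW_conj_symMat (u₀ u₁ u₂ u₃ u₄ u₅ : ℂ) :
    matW * symMat u₀ u₁ u₂ u₃ u₄ u₅ * matWᵀ = symMat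
      ((-3)*eis*u₀ + ((-4) + (-2)*eis)*u₂ + eis*u₅)
      ((2 + eis)*u₁ - eis*u₄)
      (((-2) - eis)*u₀ + eis*u₂)
      (eis*u₃)
      (-eis*u₁)
      (eis*u₀) := by
  ext i j
  fin_cases i <;> fin_cases j <;>
    simp [matW, symMat, Matrix.mul_apply, Fin.sum_univ_three]
  · linear_combination (u₀ + 2*u₂ + u₅) * eis_sq
  · linear_combination (-u₁ - u₄) * eis_sq
  · linear_combination (u₀ + u₂) * eis_sq
  · linear_combination (-u₁ - u₄) * eis_sq
  · linear_combination (u₃) * eis_sq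
  · linear_combination (-u₁) * eis_sq
  · linear_combination (u₀ + u₂) * eis_sq
  · linear_combination (-u₁) * eis_sq
  · linear_combination (u₀) * eis_sq

theorem matA_conj_symMat (u₀ u₁ u₂ u₃ u₄ u₅ : ℂ) :
    matA * symMat u₀ u₁ u₂ u₃ u₄ u₅ * matAᵀ = symMat
      (u₀ + 2*u₁ + (2)*eis*u₂ + u₃ + (2)*eis*u₄ + ((-1) - eis)*u₅)
      (u₁ - u₂ + u₃ + ((-1) + eis)*u₄ - eis*u₅)
      (u₂ + u₄ + eis*u₅)
      (u₃ + (-2)*u₄ + u₅)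
      (u₄ - u₅)
      (u₅) := by
  ext i j
  fin_cases i <;> fin_cases j <;>
    simp [matA, symMat, Matrix.mul_apply, Fin.sum_univ_three]
  · linear_combination (u₅) * eis_sq
  · ring
  · ring
  · ring
  · ring
  · ring
  · ring
  · ring

theorem matB_conj_symMat (u₀ u₁ u₂ u₃ u₄ u₅ : ℂ) :
    matB * symMat u₀ u₁ u₂ u₃ u₄ u₅ * matBᵀ = symMat
      (u₀)
      (u₀ + u₁)
      (eis*u₀ - u₁ + u₂)
      (u₀ + 2*u₁ + u₃)
      (eis*u₀ + ((-1) + eis)*u₁ + u₂ - u₃ + u₄)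
      (((-1) - eis)*u₀ + (-2)*eis*u₁ + (2)*eis*u₂ + u₃ + (-2)*u₄ + u₅) := by
  ext i j
  fin_cases i <;> fin_cases j <;>
    simp [matB, symMat, Matrix.mul_apply, Fin.sum_univ_three]
  any_goals ring1
  linear_combination (u₀) * eis_sq

/-- The value at `b⁻¹aba⁻¹` of the cocycle with values `s`, `t` at `a`, `b`, for the action of
`ρ₀` on symmetric matrices. -/
noncomputable def symCocycleWord (s t : Matrix (Fin 3) (Fin 3) ℂ) : Matrix (Fin 3) (Fin 3) ℂ :=
  -(matBinv * t * matBinvᵀ) + matBinv * s * matBinvᵀ + matBinvA * t * matBinvAᵀ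
    - matW * s * matWᵀ

/-- The first cohomology of `ρ₀` with values in the symmetric matrices vanishes. -/
theorem exists_symmetric_coboundary {s t : Matrix (Fin 3) (Fin 3) ℂ} (hs : sᵀ = s) (ht : tᵀ = t)
    (h : symCocycleWord s t + matW * t * matWᵀ - s - matA * symCocycleWord s t * matAᵀ = 0) :
    ∃ r : Matrix (Fin 3) (Fin 3) ℂ, rᵀ = r ∧ s = r - matA * r * matAᵀ ∧
      t = r - matB * r * matBᵀ := by
  obtain ⟨s₀, s₁, s₂, s₃, s₄, s₅, rfl⟩ := exists_eq_symMat hs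
  obtain ⟨t₀, t₁, t₂, t₃, t₄, t₅, rfl⟩ := exists_eq_symMat ht
  have hadd (u₀ u₁ u₂ u₃ u₄ u₅ v₀ v₁ v₂ v₃ v₄ v₅ : ℂ) : symMat u₀ u₁ u₂ u₃ u₄ u₅ +
      symMat v₀ v₁ v₂ v₃ v₄ v₅ =
      symMat (u₀ + v₀) (u₁ + v₁) (u₂ + v₂) (u₃ + v₃) (u₄ + v₄) (u₅ + v₅) := by
    ext i j
    fin_cases i <;> fin_cases j <;> rfl
  have hneg (u₀ u₁ u₂ u₃ u₄ u₅ : ℂ) : -symMat u₀ u₁ u₂ u₃ u₄ u₅ =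
      symMat (-u₀) (-u₁) (-u₂) (-u₃) (-u₄) (-u₅) := by
    ext i j
    fin_cases i <;> fin_cases j <;> rfl
  simp only [symCocycleWord, matBinv_conj_symMat, matBinvA_conj_symMat, matW_conj_symMat, hneg,
    hadd, sub_eq_add_neg, matA_conj_symMat] at h
  have h00 := congrFun (congrFun h 0) 0
  have h01 := congrFun (congrFun h 0) 1
  have h02 := congrFun (congrFun h 0) 2
  have h11 := congrFun (congrFun h 1) 1
  have h12 := congrFun (congrFun h 1) 2
  have h22 := congrFun (congrFun h 2) 2
  simp only [symMat, Matrix.of_apply, Matrix.cons_val, Matrix.zero_apply] at h00 h01 h02 h11 h12 h22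
  clear h hs ht
  -- The six unknown entries are found by solving the coboundary equations for `t₁`, `t₂`, `s₀`,
  -- `s₁`, `s₂`, `s₃`; for instance the first forces `r₀ = -t₁`. Those six then hold modulo
  -- `eis_sq`, while the other six follow from the cocycle relation. The thirds come from `(1 + 2 *
  -- eis)² = -3`.
  refine ⟨symMat (-t₁) (-eis*t₁ + t₂) (((1/3) + (2/3)*eis)*s₀ + ((-1/3) + (-2/3)*eis)*s₁ + ((1/3) +
    (-1/3)*eis)*s₂ + ((4/3) + (2/3)*eis)*t₁ + ((2/3) + (4/3)*eis)*t₂) (((1/3) + (2/3)*eis)*s₀ +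
    ((-4/3) + (-2/3)*eis)*s₁ + ((1/3) + (-1/3)*eis)*s₃ + ((4/3) + (2/3)*eis)*t₁ + ((2/3) +
    (4/3)*eis)*t₂) (((1/3) + (2/3)*eis)*s₂ + ((2/3) + (1/3)*eis)*s₃) (((2/3) + (4/3)*eis)*s₂ +
    ((1/3) + (2/3)*eis)*s₃), transpose_symMat .., ?_, ?_⟩
  · rw [matA_conj_symMat, sub_eq_add_neg, hneg, hadd]
    ext i j
    fin_cases i <;> fin_cases j <;>
      simp only [symMat, Fin.zero_eta, Fin.isValue, Fin.mk_one, Fin.reduceFinMk, Matrix.of_apply,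
        Matrix.cons_val]
    · linear_combination ((4/3)*s₀ + (4/3)*t₁ + (8/3)*t₂ + (-4/3)*s₁ + (-2/3)*s₂) * eis_sq
    · linear_combination ((-2/3)*s₂ + (-1/3)*s₃) * eis_sq
    · linear_combination ((4/3)*s₂ + (2/3)*s₃) * eis_sq
    · linear_combination ((-2/3)*s₂ + (-1/3)*s₃) * eis_sq
    · ring
    · linear_combination (1 + (2/3)*eis) * h00 + ((-1) + (4/3)*eis) * h01 + ((1/3) - eis) * h02 +
        ((-1/3) - eis) * h11 + ((7/3) + (2)*eis) * h12 + ((2/3) + (1/3)*eis) * h22 + ((-2)*s₄ + (6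
        + (14/3)*eis)*s₂ + (-7/3)*s₃ + (2 + (8/3)*eis)*s₀ + (2/3)*t₀ + (-10/3)*eis*t₁ + (3 +
        (8/3)*eis)*t₂ + ((16/3) + (5/3)*eis)*t₃ + ((10/3) + (22/3)*eis)*t₄ + (-4/3)*eis*t₅ +
        (-3)*s₅ + ((4/3) + (6)*eis)*s₁) * eis_sq
    · linear_combination ((4/3)*s₂ + (2/3)*s₃) * eis_sq
    · linear_combination (1 + (2/3)*eis) * h00 + ((-1) + (4/3)*eis) * h01 + ((1/3) - eis) * h02 +
        ((-1/3) - eis) * h11 + ((7/3) + (2)*eis) * h12 + ((2/3) + (1/3)*eis) * h22 + ((-2)*s₄ + (6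
        + (14/3)*eis)*s₂ + (-7/3)*s₃ + (2 + (8/3)*eis)*s₀ + (2/3)*t₀ + (-10/3)*eis*t₁ + (3 +
        (8/3)*eis)*t₂ + ((16/3) + (5/3)*eis)*t₃ + ((10/3) + (22/3)*eis)*t₄ + (-4/3)*eis*t₅ +
        (-3)*s₅ + ((4/3) + (6)*eis)*s₁) * eis_sq
    · linear_combination ((1/3) + (2/3)*eis) * h00 + ((-4/3) + (-2/3)*eis) * h01 + ((2/3) +
        (-2/3)*eis) * h02 + ((1/3) + (-1/3)*eis) * h11 + ((2/3) + (4/3)*eis) * h12 + ((-1)) * h22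
        + ((-2/3)*s₅ + 2*s₂ + ((4/3) + (2/3)*eis)*s₀ + (4/3)*t₀ + ((-2/3) + (-8/3)*eis)*t₁ +
        (2/3)*eis*t₂ + (1 + (-2/3)*eis)*t₃ + ((2/3) + (8/3)*eis)*t₄ + ((-2/3) + (2/3)*eis)*t₅ +
        (4/3)*eis*s₁ + (2/3)*s₄) * eis_sq
  · rw [matB_conj_symMat, sub_eq_add_neg, hneg, hadd]
    ext i j
    fin_cases i <;> fin_cases j <;>
      simp only [symMat, Fin.zero_eta, Fin.isValue, Fin.mk_one, Fin.reduceFinMk, Matrix.of_apply,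
        Matrix.cons_val]
    · linear_combination ((1/3) + (-1/3)*eis) * h00 + ((2/3) + (4/3)*eis) * h01 + ((-4/3) +
        (-2/3)*eis) * h02 + ((-2/3) + (-1/3)*eis) * h11 + ((2/3) + (-2/3)*eis) * h12 + ((-5/3)*t₀
        + ((-2/3) + (-2/3)*eis)*t₁ + ((-2/3) + (2/3)*eis)*s₀ + (2 + (2/3)*eis)*t₂ + (3 +
        (7/3)*eis)*t₃ + ((8/3) + (8/3)*eis)*t₄ + ((4/3) + (-4/3)*eis)*t₅ + (2 + (4)*eis)*s₂ +
        (-5/3)*s₅ + (2 + (10/3)*eis)*s₁ + (-10/3)*s₄ + (-2)*s₃) * eis_sq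
    · ring
    · ring
    · ring
    · linear_combination ((-1/3) + (-5/3)*eis) * h00 + ((13/3) + (11/3)*eis) * h01 + ((-8/3) +
        (-1/3)*eis) * h02 + ((-7/3) + (-2/3)*eis) * h11 + ((4/3) + (-10/3)*eis) * h12 + (1) * h22
        + ((6 + (17/3)*eis)*t₃ + ((-7/3) + (1/3)*eis)*s₀ + (4 + (14/3)*eis)*s₁ + (-4)*s₃ + ((11/3)
        + (8/3)*eis)*t₁ + (5 + (1/3)*eis)*t₂ + (-16/3)*t₀ + ((10/3) + (4/3)*eis)*t₄ + ((5/3) +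
        (-11/3)*eis)*t₅ + (2 + (8)*eis)*s₂ + (-7/3)*s₅ + (-23/3)*s₄) * eis_sq
    · linear_combination ((5/3) + (3/2)*eis) * h00 + ((-11/3)) * h01 + ((2/3) + (-7/3)*eis) * h02 +
        ((5/6) + (-7/6)*eis) * h11 + ((8/3) + (14/3)*eis) * h12 + ((-1/3) + (5/6)*eis) * h22 +
        (((20/3) + (32/3)*eis)*t₄ + (9 + (14/3)*eis)*s₂ + (-7/3)*s₃ + ((-16/3) + (-23/3)*eis)*t₁ +
        (2 + (3)*eis)*t₂ + ((8/3) + (3)*eis)*s₀ + ((10/3) + (23/3)*eis)*s₁ + (4/3)*t₀ + ((19/3) +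
        (5/6)*eis)*t₃ + (2/3)*t₅ + (-23/6)*s₅ + (-5/3)*s₄) * eis_sq
    · ring
    · linear_combination ((5/3) + (3/2)*eis) * h00 + ((-11/3)) * h01 + ((2/3) + (-7/3)*eis) * h02 +
        ((5/6) + (-7/6)*eis) * h11 + ((8/3) + (14/3)*eis) * h12 + ((-1/3) + (5/6)*eis) * h22 +
        (((20/3) + (32/3)*eis)*t₄ + (9 + (14/3)*eis)*s₂ + (-7/3)*s₃ + ((-16/3) + (-23/3)*eis)*t₁ +
        (2 + (3)*eis)*t₂ + ((8/3) + (3)*eis)*s₀ + ((10/3) + (23/3)*eis)*s₁ + (4/3)*t₀ + ((19/3) +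
        (5/6)*eis)*t₃ + (2/3)*t₅ + (-23/6)*s₅ + (-5/3)*s₄) * eis_sq
    · linear_combination ((-1/3) + (4/3)*eis) * h00 + ((-8/3) + (-10/3)*eis) * h01 + ((10/3) +
        (5/3)*eis) * h02 + ((5/3) + (4/3)*eis) * h11 + ((-8/3) + (5/3)*eis) * h12 + ((-1) - eis) *
        h22 + (((-7/3) + (10/3)*eis)*t₅ + ((-20/3) + (-10)*eis)*s₂ + 5*s₃ + (3 + (2/3)*eis)*t₁ +
        ((-10/3) + (-2/3)*eis)*t₂ + (3 + (-2/3)*eis)*s₀ + ((-28/3) + (-22/3)*eis)*s₁ + (20/3)*t₀ +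
        ((-9) + (-19/3)*eis)*t₃ + ((-26/3) + (-14/3)*eis)*t₄ + (11/3)*s₅ + (28/3)*s₄) * eis_sq

/-- There are no symmetric matrices invariant under `ρ₀`. -/
theorem eq_zero_of_symmetric_invariant {s : Matrix (Fin 3) (Fin 3) ℂ} (hs : sᵀ = s)
    (ha : matA * s * matAᵀ = s) (hb : matB * s * matBᵀ = s) : s = 0 := by
  obtain ⟨s₀, s₁, s₂, s₃, s₄, s₅, rfl⟩ := exists_eq_symMat hs
  rw [matA_conj_symMat] at ha
  rw [matB_conj_symMat] at hb
  have hc := And.intro ha hb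
  simp only [← Matrix.ext_iff, Fin.forall_fin_succ, Fin.forall_fin_zero, symMat] at hc
  simp at hc
  -- Invariance under `matA` kills `s₅`, `s₄` and gives `s₂ = s₃`; invariance under `matB` kills
  -- `s₀`, `s₁`. What remains is `(1 + 2 * eis) * s₂ = 0`, whose coefficient has square `-3`.
  have : s₀ = 0 ∧ s₁ = 0 ∧ s₂ = 0 ∧ s₃ = 0 ∧ s₄ = 0 ∧ s₅ = 0 := by grind [eis_sq]
  obtain ⟨rfl, rfl, rfl, rfl, rfl, rfl⟩ := this
  ext i j
  fin_cases i <;> fin_cases j <;> rfl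

-- Quaternionic matrices: the complex part and the part anticommuting with `i`.

local notation "Mℂ" => Matrix (Fin 3) (Fin 3) ℂ
local notation "Mℍ" => Matrix (Fin 3) (Fin 3) ℍ[ℝ]

/-- The inclusion of complex matrices into quaternionic matrices. -/
noncomputable def toQuat : Mℂ →+* Mℍ := Quaternion.ofComplex.toRingHom.mapMatrix

theorem toQuat_apply (m : Mℂ) (k l : Fin 3) : toQuat m k l = (m k l : ℍ[ℝ]) := rfl

theorem toQuat_injective : Function.Injective toQuat := by
  intro m n h
  ext k l
  have := congrFun (congrFun h k) l
  rw [toQuat_apply, toQuat_apply] at this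
  have h1 := congrArg QuaternionAlgebra.re this
  have h2 := congrArg QuaternionAlgebra.imI this
  simp only [Quaternion.re_coeComplex, Quaternion.imI_coeComplex] at h1 h2
  exact Complex.ext h1 h2

/-- The quaternion `i`. -/
noncomputable def unitI : ℍ[ℝ] := ⟨0, 1, 0, 0⟩

/-- The quaternion `j`. -/
noncomputable def unitJ : ℍ[ℝ] := ⟨0, 0, 1, 0⟩

@[simp] theorem re_unitI : unitI.re = 0 := rfl
@[simp] theorem imI_unitI : unitI.imI = 1 := rfl
@[simp] theorem imJ_unitI : unitI.imJ = 0 := rfl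
@[simp] theorem imK_unitI : unitI.imK = 0 := rfl
@[simp] theorem re_unitJ : unitJ.re = 0 := rfl
@[simp] theorem imI_unitJ : unitJ.imI = 0 := rfl
@[simp] theorem imJ_unitJ : unitJ.imJ = 1 := rfl
@[simp] theorem imK_unitJ : unitJ.imK = 0 := rfl

/-- The scalar matrix of the quaternion `i`. -/
noncomputable def quatI : Mℍ := diagonal fun _ => unitI

/-- The scalar matrix of the quaternion `j`. -/
noncomputable def quatJ : Mℍ := diagonal fun _ => unitJ

theorem quatI_mul_quatI : quatI * quatI = -1 := by
  rw [quatI, diagonal_mul_diagonal, ← diagonal_one, diagonal_neg]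
  congr 1
  ext k <;> simp

theorem quatI_mul_toQuat (m : Mℂ) : quatI * toQuat m = toQuat m * quatI := by
  ext1 k l
  rw [quatI, diagonal_mul, mul_diagonal, toQuat_apply]
  ext <;> simp

theorem quatJ_mul_toQuat (m : Mℂ) : quatJ * toQuat m = toQuat (m.map star) * quatJ := by
  ext1 k l
  rw [quatJ, diagonal_mul, mul_diagonal, toQuat_apply, toQuat_apply, map_apply]
  ext <;> simp

theorem exists_toQuat_of_commute {z : Mℍ} (hz : quatI * z = z * quatI) :
    ∃ m, z = toQuat m := by
  refine ⟨z.map fun q => ⟨q.re, q.imI⟩, ?_⟩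
  ext1 k l
  have h := congrFun (congrFun hz k) l
  rw [quatI, diagonal_mul, mul_diagonal] at h
  have h1 := congrArg QuaternionAlgebra.imJ h
  have h2 := congrArg QuaternionAlgebra.imK h
  simp at h1 h2
  rw [toQuat_apply, map_apply]
  ext <;> simp <;> linarith

theorem formJ_apply (R : Type) [Ring R] (k l : Fin 3) :
    formJ R k l = if l = k.rev then 1 else 0 := by
  fin_cases k <;> fin_cases l <;> rfl

theorem formJ_mul_apply {R : Type} [Ring R] (m : Matrix (Fin 3) (Fin 3) R) (k l : Fin 3) :
    (formJ R * m) k l = m k.rev l := by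
  simp [Matrix.mul_apply, formJ_apply]

theorem mul_formJ_apply {R : Type} [Ring R] (m : Matrix (Fin 3) (Fin 3) R) (k l : Fin 3) :
    (m * formJ R) k l = m k l.rev := by
  simp [Matrix.mul_apply, formJ_apply, ← Fin.rev_eq_iff]

theorem formJ_mul_formJ (R : Type) [Ring R] : formJ R * formJ R = 1 := by
  ext k l
  rw [formJ_mul_apply, formJ_apply, Fin.rev_rev, Matrix.one_apply]
  simp only [eq_comm]

theorem conjTranspose_formJ (R : Type) [Ring R] [StarRing R] : (formJ R)ᴴ = formJ R := by
  ext k l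
  fin_cases k <;> fin_cases l <;> simp [formJ]

theorem toQuat_formJ : toQuat (formJ ℂ) = formJ ℍ[ℝ] := by
  ext1 k l
  fin_cases k <;> fin_cases l <;> simp [formJ, toQuat_apply]

theorem conjTranspose_toQuat (m : Mℂ) : (toQuat m)ᴴ = toQuat mᴴ := by
  ext1 k l
  rw [conjTranspose_apply, toQuat_apply, toQuat_apply, conjTranspose_apply]
  ext <;> simp

/-- The adjoint with respect to the form `J`. -/
noncomputable def adjJ : Mℍ →ₗ[ℝ] Mℍ where
  toFun m := formJ ℍ[ℝ] * mᴴ * formJ ℍ[ℝ]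
  map_add' m n := by rw [conjTranspose_add, mul_add, add_mul]
  map_smul' r m := by
    have h : (r • m)ᴴ = r • mᴴ := by
      ext k l <;> simp
    rw [h, Matrix.mul_smul, Matrix.smul_mul, RingHom.id_apply]

theorem adjJ_apply (m : Mℍ) : adjJ m = formJ ℍ[ℝ] * mᴴ * formJ ℍ[ℝ] := rfl

theorem adjJ_entry (m : Mℍ) (k l : Fin 3) : adjJ m k l = star (m l.rev k.rev) := by
  rw [adjJ_apply, mul_formJ_apply, formJ_mul_apply, conjTranspose_apply]

theorem adjJ_mul (m n : Mℍ) : adjJ (m * n) = adjJ n * adjJ m := by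
  simp only [adjJ_apply, conjTranspose_mul]
  calc _ = formJ ℍ[ℝ] * nᴴ * 1 * mᴴ * formJ ℍ[ℝ] := by simp only [Matrix.mul_assoc, mul_one]
    _ = _ := by rw [← formJ_mul_formJ]; simp only [Matrix.mul_assoc]

theorem adjJ_one : adjJ 1 = 1 := by
  rw [adjJ_apply, conjTranspose_one, mul_one, formJ_mul_formJ]

theorem adjJ_adjJ (m : Mℍ) : adjJ (adjJ m) = m := by
  simp only [adjJ_apply, conjTranspose_mul, conjTranspose_formJ, conjTranspose_conjTranspose]
  calc _ = (formJ ℍ[ℝ] * formJ ℍ[ℝ]) * m * (formJ ℍ[ℝ] * formJ ℍ[ℝ]) := by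
        simp only [Matrix.mul_assoc]
    _ = m := by rw [formJ_mul_formJ, one_mul, mul_one]

theorem adjJ_toQuat (m : Mℂ) : adjJ (toQuat m) = toQuat (formJ ℂ * mᴴ * formJ ℂ) := by
  rw [adjJ_apply, conjTranspose_toQuat, ← toQuat_formJ, map_mul, map_mul]

theorem adjJ_quatI : adjJ quatI = -quatI := by
  ext1 k l
  rw [adjJ_entry, Matrix.neg_apply, quatI, diagonal_apply, diagonal_apply]
  by_cases h : k = l
  · subst h
    rw [if_pos rfl, if_pos rfl]
    ext <;> simp
  · rw [if_neg h, if_neg (fun h' => h (Fin.rev_injective h'.symm)), star_zero, neg_zero]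

theorem adjJ_eq_inv_of_mem {u : Mℍˣ} (hu : u ∈ formGroup ℍ[ℝ]) :
    adjJ (u : Mℍ) = ((u⁻¹ : Mℍˣ) : Mℍ) := by
  have h : (u : Mℍ)ᴴ * formJ ℍ[ℝ] * (u : Mℍ) = formJ ℍ[ℝ] := hu
  have h1 : adjJ (u : Mℍ) * u = 1 := by
    rw [adjJ_apply, Matrix.mul_assoc, Matrix.mul_assoc, ← Matrix.mul_assoc (u : Mℍ)ᴴ, h,
      formJ_mul_formJ]
  exact left_inv_eq_right_inv h1 u.mul_inv

/-- The elements anticommuting with `i` and skew for `adjJ`, in terms of symmetric matrices. -/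
noncomputable def symToQuat (s : Mℂ) : Mℍ := toQuat (s * formJ ℂ) * quatJ

theorem symToQuat_add (s t : Mℂ) : symToQuat (s + t) = symToQuat s + symToQuat t := by
  simp only [symToQuat, add_mul, map_add]

theorem symToQuat_neg (s : Mℂ) : symToQuat (-s) = -symToQuat s := by
  simp only [symToQuat, neg_mul, map_neg]

theorem symToQuat_sub (s t : Mℂ) : symToQuat (s - t) = symToQuat s - symToQuat t := by
  simp only [symToQuat, sub_mul, map_sub]

theorem symToQuat_injective : Function.Injective symToQuat := by
  intro s t h
  have hJ : quatJ * quatJ = -1 := by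
    rw [quatJ, diagonal_mul_diagonal, ← diagonal_one, diagonal_neg]
    congr 1
    ext k <;> simp
  have h1 := congrArg (· * quatJ) h
  simp only [symToQuat, mul_assoc, hJ, mul_neg, mul_one, neg_inj] at h1
  have h2 := congrArg (· * formJ ℂ) (toQuat_injective h1)
  simpa only [mul_assoc, formJ_mul_formJ, mul_one] using h2

/-- Passing `j` to the right conjugates the last factor, turning `gᴴ` into `gᵀ`, and `J² = 1`
cancels. As `J gᴴ J` is `g⁻¹` on U(2,1), conjugation becomes the action on symmetric forms. -/
theorem toQuat_mul_symToQuat_mul (g s : Mℂ) :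
    toQuat g * symToQuat s * toQuat (formJ ℂ * gᴴ * formJ ℂ) = symToQuat (g * s * gᵀ) := by
  have h : (formJ ℂ * gᴴ * formJ ℂ).map star = formJ ℂ * gᵀ * formJ ℂ := by
    ext1 k l
    simp only [map_apply, mul_formJ_apply, formJ_mul_apply, conjTranspose_apply, transpose_apply,
      star_star]
  rw [symToQuat, mul_assoc, mul_assoc, quatJ_mul_toQuat, h, ← mul_assoc, ← mul_assoc, ← map_mul,
    ← map_mul, symToQuat]
  congr 2
  calc _ = g * s * (formJ ℂ * formJ ℂ) * gᵀ * formJ ℂ := by simp only [mul_assoc]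
    _ = _ := by rw [formJ_mul_formJ, mul_one]

/-- Anticommuting with `i` leaves only `r j` with `r` complex, and skewness for `adjJ` then says
that `r J` is symmetric. -/
theorem exists_symToQuat {z : Mℍ} (hz : quatI * z = -(z * quatI)) (hz' : adjJ z = -z) :
    ∃ s : Mℂ, sᵀ = s ∧ z = symToQuat s := by
  have key (k l) : (z k l).re = 0 ∧ (z k l).imI = 0 := by
    have h := congrFun (congrFun hz k) l
    rw [Matrix.neg_apply, quatI, diagonal_mul, mul_diagonal] at h
    have h1 := congrArg QuaternionAlgebra.re h
    have h2 := congrArg QuaternionAlgebra.imI h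
    simp at h1 h2
    constructor <;> linarith
  let r : Mℂ := z.map fun q => ⟨q.imJ, q.imK⟩
  have hr : z = toQuat r * quatJ := by
    ext1 k l
    rw [quatJ, mul_diagonal, toQuat_apply]
    ext <;> simp [r, key k l]
  refine ⟨r * formJ ℂ, ?_, ?_⟩
  · ext1 k l
    rw [transpose_apply, mul_formJ_apply, mul_formJ_apply]
    have e := congrFun (congrFun hz' k) l.rev
    rw [adjJ_entry, Fin.rev_rev, Matrix.neg_apply] at e
    have e1 := congrArg QuaternionAlgebra.imJ e
    have e2 := congrArg QuaternionAlgebra.imK e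
    simp at e1 e2
    exact Complex.ext e1 e2
  · rw [symToQuat, mul_assoc, formJ_mul_formJ, mul_one, hr]

theorem symToQuat_mem {s : Mℂ} (hs : sᵀ = s) :
    quatI * symToQuat s = -(symToQuat s * quatI) ∧ adjJ (symToQuat s) = -symToQuat s := by
  have hIJ : quatJ * quatI = -(quatI * quatJ) := by
    rw [quatJ, quatI, diagonal_mul_diagonal, diagonal_mul_diagonal, diagonal_neg]
    congr 1
    ext k <;> simp
  constructor
  · rw [symToQuat, mul_assoc _ _ quatI, hIJ, ← mul_assoc, quatI_mul_toQuat]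
    simp only [mul_neg, mul_assoc, neg_neg]
  · have h1 : quatJᴴ = -quatJ := by
      rw [quatJ, diagonal_conjTranspose, diagonal_neg]
      congr 1
      ext k <;> simp
    have h2 : (s * formJ ℂ)ᴴ.map star = formJ ℂ * s := by
      conv_rhs => rw [← hs]
      ext1 k l
      simp only [map_apply, mul_formJ_apply, formJ_mul_apply, conjTranspose_apply,
        transpose_apply, star_star]
    have h3 : quatJ * formJ ℍ[ℝ] = formJ ℍ[ℝ] * quatJ := by
      ext1 k l
      rw [quatJ, diagonal_mul, mul_diagonal]
      rw [formJ_apply]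
      split_ifs <;> simp
    rw [adjJ_apply, symToQuat, conjTranspose_mul, conjTranspose_toQuat, h1, neg_mul,
      quatJ_mul_toQuat, h2, mul_neg, neg_mul, mul_assoc, mul_assoc, h3, ← toQuat_formJ,
      ← mul_assoc, ← mul_assoc, ← map_mul, ← map_mul]
    congr 3
    rw [← mul_assoc, formJ_mul_formJ, one_mul]

-- This norm makes the matrices a normed algebra and induces the entrywise topology, the one carried
-- by `Sp21`.
attribute [local instance] Matrix.linftyOpNormedRing Matrix.linftyOpNormedAlgebra

theorem formJ_matA : formJ ℂ * matAᴴ * formJ ℂ = matAinv := by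
  have h : (starRingEnd ℂ) eis = -1 - eis := star_eis
  ext1 k l
  rw [mul_formJ_apply, formJ_mul_apply, conjTranspose_apply]
  fin_cases k <;> fin_cases l <;> simp [matA, matAinv, h]

theorem formJ_matB : formJ ℂ * matBᴴ * formJ ℂ = matBinv := by
  have h : (starRingEnd ℂ) eis = -1 - eis := star_eis
  ext1 k l
  rw [mul_formJ_apply, formJ_mul_apply, conjTranspose_apply]
  fin_cases k <;> fin_cases l <;> simp [matB, matBinv, h]

theorem formJ_matAinv : formJ ℂ * matAinvᴴ * formJ ℂ = matA := by
  have h : (starRingEnd ℂ) eis = -1 - eis := star_eis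
  ext1 k l
  rw [mul_formJ_apply, formJ_mul_apply, conjTranspose_apply]
  fin_cases k <;> fin_cases l <;> simp [matA, matAinv, h]

theorem formJ_matBinv : formJ ℂ * matBinvᴴ * formJ ℂ = matB := by
  have h : (starRingEnd ℂ) eis = -1 - eis := star_eis
  ext1 k l
  rw [mul_formJ_apply, formJ_mul_apply, conjTranspose_apply]
  fin_cases k <;> fin_cases l <;> simp [matB, matBinv, h]

/-- Each term of the Fox derivative is a conjugate by a prefix of the relation, so the equivariance
of `symToQuat` applies term by term. -/
theorem foxRelation_symToQuat (s t : Mℂ) :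
    foxRelation (toQuat matA) (toQuat matAinv) (toQuat matB) (toQuat matBinv)
      (symToQuat s) (symToQuat t) =
    symToQuat (symCocycleWord s t + matW * t * matWᵀ - s - matA * symCocycleWord s t * matAᵀ) := by
  have hA (r : Mℂ) : toQuat matA * symToQuat r * toQuat matAinv = symToQuat (matA * r * matAᵀ) := by
    rw [← formJ_matA, toQuat_mul_symToQuat_mul]
  have hA' (r : Mℂ) : toQuat matAinv * symToQuat r * toQuat matA =
      symToQuat (matAinv * r * matAinvᵀ) := by
    conv_lhs => rw [← formJ_matAinv]
    rw [formJ_matAinv, ← toQuat_mul_symToQuat_mul, formJ_matAinv]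
  have hB (r : Mℂ) : toQuat matB * symToQuat r * toQuat matBinv = symToQuat (matB * r * matBᵀ) := by
    rw [← formJ_matB, toQuat_mul_symToQuat_mul]
  have hB' (r : Mℂ) : toQuat matBinv * symToQuat r * toQuat matB =
      symToQuat (matBinv * r * matBinvᵀ) := by
    rw [← toQuat_mul_symToQuat_mul, formJ_matBinv]
  have hBA (r : Mℂ) : toQuat matBinv * toQuat matA * symToQuat r * toQuat matAinv * toQuat matB =
      symToQuat (matBinvA * r * matBinvAᵀ) := by
    calc _ = toQuat matBinv * (toQuat matA * symToQuat r * toQuat matAinv) * toQuat matB := by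
          simp only [mul_assoc]
      _ = _ := by
          rw [hA, hB', ← matBinv_mul_matA, transpose_mul]
          simp only [mul_assoc]
  have hW (r : Mℂ) : toQuat matBinv * toQuat matA * toQuat matB * toQuat matAinv * symToQuat r *
      toQuat matA * toQuat matBinv * toQuat matAinv * toQuat matB =
      symToQuat (matW * r * matWᵀ) := by
    calc _ = toQuat matBinv * toQuat matA * (toQuat matB * (toQuat matAinv * symToQuat r *
          toQuat matA) * toQuat matBinv) * toQuat matAinv * toQuat matB := by
          simp only [mul_assoc]
      _ = _ := by
          rw [hA', hB, hBA, ← matBinvA_mul_matB_mul_matAinv, transpose_mul, transpose_mul]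
          simp only [mul_assoc]
  have hc : cocycleWord (toQuat matA) (toQuat matAinv) (toQuat matB) (toQuat matBinv)
      (symToQuat s) (symToQuat t) = symToQuat (symCocycleWord s t) := by
    rw [cocycleWord, hB', hB', hBA, hW, symCocycleWord, symToQuat_sub, symToQuat_add,
      symToQuat_add, symToQuat_neg]
  rw [foxRelation, hc, hW, hA, symToQuat_sub, symToQuat_sub, symToQuat_add]

/-! ### Returning to representations of the knot group. -/

theorem inclUSp_coe (u : U21) : ((inclUSp u : Mℍˣ) : Mℍ) = toQuat ((u : Mℂˣ) : Mℂ) := rfl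

theorem inclUSp_injective : Function.Injective inclUSp := by
  intro u v h
  have h1 : toQuat ((u : Mℂˣ) : Mℂ) = toQuat ((v : Mℂˣ) : Mℂ) := by
    rw [← inclUSp_coe, ← inclUSp_coe, h]
  exact Subtype.ext (Units.ext (toQuat_injective h1))

/-- The inverse commutes with `i` too, so both are complex matrices; injectivity of `toQuat` makes
them mutually inverse and carries the form condition down. -/
theorem mem_range_inclUSp {h : Sp21}
    (hh : quatI * ((h : Mℍˣ) : Mℍ) = ((h : Mℍˣ) : Mℍ) * quatI) : h ∈ inclUSp.range := by
  have hc : Commute quatI ((h : Mℍˣ) : Mℍ) := hh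
  obtain ⟨m, hm⟩ := exists_toQuat_of_commute hh
  obtain ⟨n, hn⟩ := exists_toQuat_of_commute (hc.units_inv_right).eq
  have hmn : m * n = 1 := toQuat_injective (by rw [map_mul, ← hm, ← hn, map_one, Units.mul_inv])
  have hnm : n * m = 1 := toQuat_injective (by rw [map_mul, ← hm, ← hn, map_one, Units.inv_mul])
  have hmem : (⟨m, n, hmn, hnm⟩ : Mℂˣ) ∈ formGroup ℂ := by
    change mᴴ * formJ ℂ * m = formJ ℂ
    apply toQuat_injective
    rw [map_mul, map_mul, toQuat_formJ, ← conjTranspose_toQuat, ← hm]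
    exact h.2
  exact ⟨⟨_, hmem⟩, Subtype.ext (Units.ext hm.symm)⟩

theorem rho0_genA : ((rho0 genA : Mℍˣ) : Mℍ) = toQuat matA := by
  change ((inclUSp ((rho0SU genA : SU21) : U21) : Mℍˣ) : Mℍ) = _
  rw [rho0SU_genA]
  rfl

theorem rho0_genB : ((rho0 genB : Mℍˣ) : Mℍ) = toQuat matB := by
  change ((inclUSp ((rho0SU genB : SU21) : U21) : Mℍˣ) : Mℍ) = _
  rw [rho0SU_genB]
  rfl

theorem continuous_eval_coe (γ : Gamma8) :
    Continuous fun ρ : Gamma8 →* Sp21 => ((ρ γ : Mℍˣ) : Mℍ) :=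
  Units.continuous_val.comp (continuous_subtype_val.comp
    ((continuous_apply γ).comp continuous_induced_dom))

theorem relation_apply {G : Type*} [Group G] (ρ : Gamma8 →* G) :
    (ρ genB)⁻¹ * ρ genA * ρ genB * (ρ genA)⁻¹ * ρ genB =
      ρ genA * ((ρ genB)⁻¹ * ρ genA * ρ genB * (ρ genA)⁻¹) := by
  have h : (PresentedGroup.mk {relator} relator : Gamma8) = 1 :=
    PresentedGroup.one_of_mem rfl
  have h1 : genB⁻¹ * genA * genB * genA⁻¹ * genB * genA * genB⁻¹ * genA⁻¹ * genB * genA⁻¹ = 1 := h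
  have h2 := congrArg ρ h1
  simp only [map_mul, map_inv, map_one] at h2
  generalize ρ genA = x at *
  generalize ρ genB = y at *
  calc _ = (y⁻¹ * x * y * x⁻¹ * y * x * y⁻¹ * x⁻¹ * y * x⁻¹) *
        (x * (y⁻¹ * x * y * x⁻¹)) := by group
    _ = _ := by rw [h2, one_mul]

theorem exists_conj_into_U21 {ρ : Gamma8 →* Sp21} (g : Sp21)
    (hA : g * ρ genA * g⁻¹ ∈ inclUSp.range) (hB : g * ρ genB * g⁻¹ ∈ inclUSp.range) :
    ∃ σ : Gamma8 →* U21, ∀ γ, g * ρ γ * g⁻¹ = inclUSp (σ γ) := by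
  let τ : Gamma8 →* Sp21 := (MulAut.conj g).toMonoidHom.comp ρ
  have hτ : ∀ γ, τ γ ∈ inclUSp.range := by
    have : (inclUSp.range).comap τ = ⊤ := by
      rw [eq_top_iff, ← PresentedGroup.closure_range_of, Subgroup.closure_le]
      rintro _ ⟨k, rfl⟩
      fin_cases k
      · exact hA
      · exact hB
    intro γ
    have h : γ ∈ (inclUSp.range).comap τ := by rw [this]; trivial
    exact h
  let e := MonoidHom.ofInjective inclUSp_injective
  refine ⟨e.symm.toMonoidHom.comp (τ.codRestrict _ hτ), fun γ => ?_⟩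
  have h := congrArg Subtype.val (e.apply_symm_apply ⟨τ γ, hτ γ⟩)
  exact h.symm

/-- All representations near `ρ₀` are conjugate into `U(2,1)`. -/
theorem eventually_exists_conj_into_U21 :
    ∀ᶠ ρ : Gamma8 →* Sp21 in 𝓝 rho0,
      ∃ (g : Sp21) (σ : Gamma8 →* U21), ∀ γ : Gamma8, g * ρ γ * g⁻¹ = inclUSp (σ γ) := by
  have hadjA : adjJ (toQuat matA) = toQuat matAinv := by rw [adjJ_toQuat, formJ_matA]
  have hadjB : adjJ (toQuat matB) = toQuat matBinv := by rw [adjJ_toQuat, formJ_matB]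
  have hA1 : toQuat matA * toQuat matAinv = 1 := by
    rw [← map_mul, show matA * matAinv = 1 from unitA.mul_inv, map_one]
  have hA2 : toQuat matAinv * toQuat matA = 1 := by
    rw [← map_mul, show matAinv * matA = 1 from unitA.inv_mul, map_one]
  have hB1 : toQuat matB * toQuat matBinv = 1 := by
    rw [← map_mul, show matB * matBinv = 1 from unitB.mul_inv, map_one]
  have hB2 : toQuat matBinv * toQuat matB = 1 := by
    rw [← map_mul, show matBinv * matB = 1 from unitB.inv_mul, map_one]
  have hconjA (r : Matrix (Fin 3) (Fin 3) ℂ) :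
      toQuat matA * symToQuat r * toQuat matAinv = symToQuat (matA * r * matAᵀ) := by
    rw [← formJ_matA, toQuat_mul_symToQuat_mul]
  have hconjB (r : Matrix (Fin 3) (Fin 3) ℂ) :
      toQuat matB * symToQuat r * toQuat matBinv = symToQuat (matB * r * matBᵀ) := by
    rw [← formJ_matB, toQuat_mul_symToQuat_mul]
  have key := eventually_exists_conj_commute adjJ adjJ_mul adjJ_one adjJ_adjJ quatI_mul_quatI
    adjJ_quatI (x₀ := toQuat matA) (y₀ := toQuat matB) (by rw [hadjA, hA1]) (by rw [hadjA, hA2])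
    (by rw [hadjB, hB1]) (by rw [hadjB, hB2]) (quatI_mul_toQuat _) (quatI_mul_toQuat _)
    (by
      rintro z ⟨hz, hz'⟩ hxz hyz
      obtain ⟨s, hs, rfl⟩ := exists_symToQuat hz hz'
      rw [eq_zero_of_symmetric_invariant hs]
      · simp [symToQuat]
      · apply symToQuat_injective
        rw [← hconjA, hxz, mul_assoc, hA1, mul_one]
      · apply symToQuat_injective
        rw [← hconjB, hyz, mul_assoc, hB1, mul_one])
    (by
      rintro c ⟨hc, hc'⟩ d ⟨hd, hd'⟩ h
      obtain ⟨s, hs, rfl⟩ := exists_symToQuat hc hc'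
      obtain ⟨t, ht, rfl⟩ := exists_symToQuat hd hd'
      rw [hadjA, hadjB, foxRelation_symToQuat] at h
      have h0 : symToQuat 0 = 0 := by simp [symToQuat]
      obtain ⟨r, hr, hsr, htr⟩ := exists_symmetric_coboundary hs ht
        (symToQuat_injective (h.trans h0.symm))
      refine ⟨symToQuat r, symToQuat_mem hr, ?_, ?_⟩
      · rw [hadjA, hconjA, ← symToQuat_sub, ← hsr]
      · rw [hadjB, hconjB, ← symToQuat_sub, ← htr])
  have hcont : Filter.Tendsto (fun ρ : Gamma8 →* Sp21 =>
      (((ρ genA : (Matrix (Fin 3) (Fin 3) ℍ[ℝ])ˣ) : Matrix (Fin 3) (Fin 3) ℍ[ℝ]),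
        ((ρ genB : (Matrix (Fin 3) (Fin 3) ℍ[ℝ])ˣ) : Matrix (Fin 3) (Fin 3) ℍ[ℝ])))
      (𝓝 rho0) (𝓝 (toQuat matA, toQuat matB)) := by
    rw [← rho0_genA, ← rho0_genB]
    exact ((continuous_eval_coe genA).prodMk (continuous_eval_coe genB)).tendsto rho0
  filter_upwards [hcont.eventually key] with ρ hρ
  have hx := adjJ_eq_inv_of_mem (ρ genA).2
  have hy := adjJ_eq_inv_of_mem (ρ genB).2
  obtain ⟨g, hg1, hg2, hgA, hgB⟩ := hρ (by rw [hx, Units.mul_inv]) (by rw [hx, Units.inv_mul])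
    (by rw [hy, Units.mul_inv]) (by rw [hy, Units.inv_mul]) (by
      rw [hx, hy]
      exact congrArg (fun u : Sp21 => ((u : (Matrix (Fin 3) (Fin 3) ℍ[ℝ])ˣ) :
        Matrix (Fin 3) (Fin 3) ℍ[ℝ])) (relation_apply ρ))
  have hmem : (⟨g, adjJ g, hg1, hg2⟩ : (Matrix (Fin 3) (Fin 3) ℍ[ℝ])ˣ) ∈ formGroup ℍ[ℝ] := by
    change gᴴ * formJ ℍ[ℝ] * g = formJ ℍ[ℝ]
    calc _ = formJ ℍ[ℝ] * formJ ℍ[ℝ] * (gᴴ * formJ ℍ[ℝ] * g) := by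
          rw [formJ_mul_formJ, one_mul]
      _ = formJ ℍ[ℝ] * (adjJ g * g) := by rw [adjJ_apply]; simp only [mul_assoc]
      _ = _ := by rw [hg2, mul_one]
  -- The rigidity statement makes `g⁻¹ ρ g` commute with `i`, so the conjugating element is `g⁻¹`.
  refine ⟨⟨_, hmem⟩⁻¹, exists_conj_into_U21 _ (mem_range_inclUSp ?_) (mem_range_inclUSp ?_)⟩
  · rw [inv_inv]
    exact hgA
  · rw [inv_inv]
    exact hgB

end FigureEight

open FigureEight in
theorem proposition2p1 :
    ∀ᶠ ρ : Gamma8 →* Sp21 in 𝓝 rho0,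
      ∃ (g : Sp21) (σ : Gamma8 →* U21), ∀ γ : Gamma8, g * ρ γ * g⁻¹ = inclUSp (σ γ) := by
  exact eventually_exists_conj_into_U21
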